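/- Set $\hbar=1$. A system with position and momentum $Q,P$ on $L^2(\mathbb R)$ is coupled to two probes with positions and momenta $Q_1,P_1,Q_2,P_2$ on $L^2(\mathbb R^2)$. Let $\lambda,\mu>0$, $\kappa\in\mathbb R$ and $$H=\lambda QP_1-\mu PQ_2+\tfrac{\lambda\mu}{2}\kappa P_1Q_2,\qquad U=\exp(-iH)\ \text{ on } L^2(\mathbb R^3).$$ ($U$ is the time-one member of the strongly continuous one-parameter unitary group whose generator is $-iH$ on Schwartz functions; it exists and is unique, also when $\lambda$ or $\mu$ is replaced by $0$.) Let the probes be in a state $\sigma=\sum_i p_i|\varphi_i\rangle\langle\varphi_i|$, where the sum is countable, $p_i\ge0$, $\sum_ip_i=1$ and the $\varphi_i\in L^2(\mathbb R^2)$ are unit vectors. Write $\tilde\varphi(p_1,p_2)=\frac1{2\pi}\int e^{-i(p_1q_1+p_2q_2)}\varphi(q_1,q_2)\,dq_1dq_2$ (Plancherel transform). Averages $\langle g(Q_1,Q_2)\rangle_\sigma$ and $\langle g(P_1,P_2)\rangle_\sigma$ are integrals of $g$ against the densities $\sum_ip_i|\varphi_i|^2$ and $\sum_ip_i|\tilde\varphi_i|^2$;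 further $\mathrm{Var}(A,\sigma)=\langle A^2\rangle_\sigma-\langle A\rangle_\sigma^2$ and $\mathrm{Cov}(A,B,\sigma)=\langle AB\rangle_\sigma-\langle A\rangle_\sigma\langle B\rangle_\sigma$. The observable $\mathsf G^{(\lambda,\mu)}$ of the system is defined by $$\langle\psi,\mathsf G^{(\lambda,\mu)}(X\times Y)\psi\rangle=\sum_ip_i\big\langle U(\psi\otimes\varphi_i),\,\big(I\otimes \mathsf E^{Q_1}(\lambda X)\otimes \mathsf E^{P_2}(\mu Y)\big)U(\psi\otimes\varphi_i)\big\rangle ,$$ where $\mathsf E^{Q_1},\mathsf E^{P_2}$ are the spectral measures of $Q_1,P_2$. Let $\mathsf E^{(\lambda,\mu)}(X)=\mathsf G^{(\lambda,\mu)}(X\times\mathbb R)$ and $\mathsf F^{(\lambda,\mu)}(Y)=\mathsf G^{(\lambda,\mu)}(\mathbb R\times Y)$. Let $\mathsf E^{(\lambda,0)}$ be the observable obtained with $\mu=0$ in $U$ by measuring only $\mathsf E^{Q_1}(\lambda X)$, and $\mathsf F^{(0,\mu)}$ the one obtained with $\lambda=0$ in $U$ by measuring only $\mathsf E^{P_2}(\mu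 Y)$. 1. **Marginals.** For all Borel sets $X,Y\subseteq\mathbb R$, $\mathsf E^{(\lambda,\mu)}(X)=(\chi_X*e)(Q)$ and $\mathsf F^{(\lambda,\mu)}(Y)=(\chi_Y*f)(P)$, with the probability densities $$e(q)=\frac\lambda\mu\sum_ip_i\int\Big|\varphi_i\big(\lambda(\tfrac12(1-\kappa)q'-q),\tfrac{q'}\mu\big)\Big|^2dq',\qquad f(p)=\frac\mu\lambda\sum_ip_i\int\Big|\tilde\varphi_i\big(\tfrac w\lambda,\mu(\tfrac w2(\kappa+1)-p)\big)\Big|^2dw .$$ Likewise $\mathsf E^{(\lambda,0)}(X)=(\chi_X*e_0)(Q)$ and $\mathsf F^{(0,\mu)}(Y)=(\chi_Y*f_0)(P)$ with the probability densities $e_0(q)=\lambda\sum_ip_i\int|\varphi_i(-\lambda q,q_2)|^2dq_2$ and $f_0(p)=\mu\sum_ip_i\int|\tilde\varphi_i(p_1,-\mu p)|^2dp_1$. 2. **Moments and variances.** If $Q_1,Q_2$ have finite first absolute moments in $\sigma$, then $e$ has a finite first moment $e[1]=\frac\mu2(1-\kappa)\langle Q_2\rangle_\sigma-\frac1\lambda\langle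 Q_1\rangle_\sigma$. If they have finite second moments, then so does $e$, and $$e[2]=\tfrac{\mu^2}4(1-\kappa)^2\langle Q_2^2\rangle_\sigma+\tfrac1{\lambda^2}\langle Q_1^2\rangle_\sigma-\tfrac\mu\lambda(1-\kappa)\langle Q_1Q_2\rangle_\sigma,$$ $$\mathrm{Var}(e)=\tfrac1{\lambda^2}\mathrm{Var}(Q_1,\sigma)+\tfrac{\mu^2}4(1-\kappa)^2\mathrm{Var}(Q_2,\sigma)-\tfrac\mu\lambda(1-\kappa)\mathrm{Cov}(Q_1,Q_2,\sigma),$$ and $\mathrm{Var}(e_0)=\lambda^{-2}\mathrm{Var}(Q_1,\sigma)$. Under the corresponding assumptions on $P_1,P_2$, $f[1]=\frac\lambda2(1+\kappa)\langle P_1\rangle_\sigma-\frac1\mu\langle P_2\rangle_\sigma$, $$f[2]=\tfrac{\lambda^2}4(1+\kappa)^2\langle P_1^2\rangle_\sigma+\tfrac1{\mu^2}\langle P_2^2\rangle_\sigma-\tfrac\lambda\mu(1+\kappa)\langle P_1P_2\rangle_\sigma,$$ $$\mathrm{Var}(f)=\tfrac{\lambda^2}4(1+\kappa)^2\mathrm{Var}(P_1,\sigma)+\tfrac1{\mu^2}\mathrm{Var}(P_2,\sigma)-\tfrac\lambda\mu(1+\kappa)\mathrm{Cov}(P_1,P_2,\sigma),$$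 and $\mathrm{Var}(f_0)=\mu^{-2}\mathrm{Var}(P_2,\sigma)$. 3. **Di Lorenzo's quantities.** For a unit vector $\psi\in L^2(\mathbb R)$ let $\mathrm{Var}(\mathsf A,\psi)$ be the variance of the outcome distribution $X\mapsto\langle\psi,\mathsf A(X)\psi\rangle$. If $Q_1,Q_2$ have finite second moments in $\sigma$ and $Q$ has a finite second moment in $\psi$, then $$\Delta_{DL}(Q):=\mathrm{Var}(\mathsf E^{(\lambda,\mu)},\psi)-\mathrm{Var}(\mathsf E^{(\lambda,0)},\psi)=\mathrm{Var}(e)-\mathrm{Var}(e_0)=\tfrac{(1-\kappa)^2}4\mu^2\,\mathrm{Var}(Q_2,\sigma)-\tfrac{1-\kappa}\lambda\mu\,\mathrm{Cov}(Q_1,Q_2,\sigma),$$ all variances being finite. If $P_1,P_2$ have finite second moments in $\sigma$ and $P$ in $\psi$, then $$\Delta_{DL}(P):=\mathrm{Var}(\mathsf F^{(\lambda,\mu)},\psi)-\mathrm{Var}(\mathsf F^{(0,\mu)},\psi)=\mathrm{Var}(f)-\mathrm{Var}(f_0)=\tfrac{(1+\kappa)^2}4\lambda^2\,\mathrm{Var}(P_1,\sigma)-\tfrac{1+\kappa}\mu\lambda\,\mathrm{Cov}(P_1,P_2,\sigma).$$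 4. **Negativity.** For all $\lambda,\mu>0$ and $\kappa\in\mathbb R$ there is a probe state $\sigma$, a mixture of two pure states with finite second moments of $Q_1,Q_2,P_1,P_2$ and with $\mathrm{Cov}(Q_1,Q_2,\sigma)\ne0\ne\mathrm{Cov}(P_1,P_2,\sigma)$, such that $\Delta_{DL}(Q)<0$ if $\kappa\ne1$, and $\Delta_{DL}(P)<0$ if $\kappa\ne-1$, for all unit vectors $\psi$ in which $Q$, respectively $P$, has a finite second moment. -/

import Mathlib

open MeasureTheory
open scoped SchwartzMap FourierTransform ENNReal Convolution Pointwise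

namespace ArthursKelly

noncomputable section

/-! Planck's constant is `1`.  The system has configuration space `ℝ`, the two probes together have
`EuclideanSpace ℝ (Fin 2)` (coordinates `q₁ = x 0`, `q₂ = x 1`), and the three particles together
have `EuclideanSpace ℝ (Fin 3)` (coordinates `q = x 0`, `q₁ = x 1`, `q₂ = x 2`). -/

/-- The configuration space of `n` particles on the line. -/
abbrev Conf (n : ℕ) : Type := EuclideanSpace ℝ (Fin n)

/-- The Hilbert space `L²(E)` of complex square-integrable functions. -/
abbrev L2 (E : Type*) [NormedAddCommGroup E] [InnerProductSpace ℝ E] [FiniteDimensional ℝ E]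
    [MeasurableSpace E] [BorelSpace E] : Type _ := Lp ℂ 2 (volume : Measure E)

/-! ### The coupling `U = exp(-iH)` -/

/-- The position operator `Q_j` on Schwartz functions. -/
def posOp {n : ℕ} (j : Fin n) : 𝓢(Conf n, ℂ) →L[ℂ] 𝓢(Conf n, ℂ) :=
  SchwartzMap.smulLeftCLM ℂ (fun x : Conf n => ((x j : ℝ) : ℂ))

theorem posOp_apply {n : ℕ} (j : Fin n) (f : 𝓢(Conf n, ℂ)) (x : Conf n) :
    posOp j f x = (x j : ℂ) * f x := by
  have h : Function.HasTemperateGrowth (fun x : Conf n => ((x j : ℝ) : ℂ)) :=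
    (Complex.ofRealCLM.comp (EuclideanSpace.proj j : Conf n →L[ℝ] ℝ)).hasTemperateGrowth
  simp [posOp, SchwartzMap.smulLeftCLM_apply_apply h]

/-- The momentum operator `P_j = -i ∂_j` on Schwartz functions. -/
def momOp {n : ℕ} (j : Fin n) : 𝓢(Conf n, ℂ) →L[ℂ] 𝓢(Conf n, ℂ) :=
  (-Complex.I) • LineDeriv.lineDerivOpCLM ℂ 𝓢(Conf n, ℂ) (EuclideanSpace.single j (1 : ℝ))

/-- The interaction Hamiltonian `H = lam Q P₁ - mu P Q₂ + (lam mu / 2) kap P₁ Q₂`. -/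
def hamiltonian (lam mu kap : ℝ) : 𝓢(Conf 3, ℂ) →L[ℂ] 𝓢(Conf 3, ℂ) :=
  (lam : ℂ) • (posOp 0 ∘L momOp 1) - (mu : ℂ) • (momOp 0 ∘L posOp 2)
    + ((lam * mu / 2 * kap : ℝ) : ℂ) • (momOp 1 ∘L posOp 2)

/-- `U = exp(-iH)`: `U` is the time-one member of a strongly continuous one-parameter unitary group
on `L²` whose generator is `-iH` on the Schwartz functions. -/
def IsExpNegI {n : ℕ} (H : 𝓢(Conf n, ℂ) →L[ℂ] 𝓢(Conf n, ℂ))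
    (U : L2 (Conf n) ≃ₗᵢ[ℂ] L2 (Conf n)) : Prop :=
  ∃ V : ℝ → (L2 (Conf n) ≃ₗᵢ[ℂ] L2 (Conf n)),
    (∀ s t, V (s + t) = V s * V t) ∧
    (∀ ψ, Continuous fun t => V t ψ) ∧
    (∀ f : 𝓢(Conf n, ℂ), HasDerivAt (fun t => V t (f.toLp 2 volume))
      ((-Complex.I) • (H f).toLp 2 volume) 0) ∧
    V 1 = U

/-- The coupling unitary `U = exp(-iH)`. -/
def coupling (lam mu kap : ℝ) : L2 (Conf 3) ≃ₗᵢ[ℂ] L2 (Conf 3) :=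
  Classical.epsilon (IsExpNegI (hamiltonian lam mu kap))

/-! ### Position, momentum and their spectral measures -/

open Classical in
/-- Multiplication by the indicator function of `S` on `L²(E)` (for measurable `S`). -/
def indicatorOp {E : Type*} [NormedAddCommGroup E] [InnerProductSpace ℝ E]
    [FiniteDimensional ℝ E] [MeasurableSpace E] [BorelSpace E] (S : Set E) : L2 E →L[ℂ] L2 E :=
  if hS : MeasurableSet S then
    (ContinuousLinearMap.mul ℂ ℂ).holderL volume ∞ 2 2
      ((memLp_top_of_bound (f := S.indicator (fun _ => (1 : ℂ)))
        ((measurable_const.indicator hS).aestronglyMeasurable) 1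
        (Filter.Eventually.of_forall fun x => by
          by_cases h : x ∈ S <;> simp [h])).toLp _)
  else 0

/-- The spectral projection `E^{Q_j}(X)` of the position `Q_j`. -/
def posProj {n : ℕ} (j : Fin n) (X : Set ℝ) : L2 (Conf n) →L[ℂ] L2 (Conf n) :=
  indicatorOp {x : Conf n | x j ∈ X}

/-- The Fourier transform on `L²(ℝⁿ)`, with kernel `exp(-2πi⟨x, ξ⟩)`; the momentum is `2πξ`. -/
def fourierL2 (n : ℕ) : L2 (Conf n) ≃ₗᵢ[ℂ] L2 (Conf n) := Lp.fourierTransformₗᵢ (Conf n) ℂ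

/-- The spectral projection `E^{P_j}(Y)` of the momentum `P_j`. -/
def momProj {n : ℕ} (j : Fin n) (Y : Set ℝ) : L2 (Conf n) →L[ℂ] L2 (Conf n) :=
  (fourierL2 n).symm.toContinuousLinearEquiv.toContinuousLinearMap ∘L
    indicatorOp {ξ : Conf n | 2 * Real.pi * ξ j ∈ Y} ∘L
      (fourierL2 n).toContinuousLinearEquiv.toContinuousLinearMap

section Wave

variable {E : Type*} [NormedAddCommGroup E] [InnerProductSpace ℝ E] [FiniteDimensional ℝ E]
  [MeasurableSpace E] [BorelSpace E]

/-- The momentum-space wave function `φ̃(p) = (2π)^{-d/2} ∫ exp(-i⟨p, x⟩) φ(x) dx` of `φ ∈ L²(E)`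
(in the sense of Plancherel), `d = dim E`. -/
def momWave (φ : L2 E) (p : E) : ℂ :=
  (((2 * Real.pi) ^ (-(Module.finrank ℝ E : ℝ) / 2) : ℝ) : ℂ) *
    (Lp.fourierTransformₗᵢ E ℂ φ : L2 E) ((2 * Real.pi)⁻¹ • p)

/-- The position distribution of the vector state `φ`. -/
def posLaw (φ : L2 E) : Measure E := volume.withDensity fun x => ‖φ x‖ₑ ^ 2

/-- The momentum distribution of the vector state `φ`. -/
def momLaw (φ : L2 E) : Measure E := volume.withDensity fun p => ‖momWave φ p‖ₑ ^ 2

end Wave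

/-- `T = g(Q)` on `L²(ℝ)`. -/
def IsFunOfPos (T : L2 ℝ →L[ℂ] L2 ℝ) (g : ℝ → ℝ) : Prop :=
  ∀ ψ : L2 ℝ, (T ψ : ℝ → ℂ) =ᵐ[volume] fun x => (g x : ℂ) * ψ x

/-- `T = g(P)` on `L²(ℝ)`. -/
def IsFunOfMom (T : L2 ℝ →L[ℂ] L2 ℝ) (g : ℝ → ℝ) : Prop :=
  ∀ ψ : L2 ℝ, momWave (T ψ) =ᵐ[volume] fun p => (g p : ℂ) * momWave ψ p

/-! ### Probe states -/

/-- A state `σ = ∑ᵢ pᵢ |φᵢ⟩⟨φᵢ|` of the two probes: a (countable) mixture of arbitrary pure states.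
Every density operator is of this form. -/
structure ProbeState (ι : Type*) where
  weight : ι → ℝ
  vec : ι → L2 (Conf 2)
  weight_nonneg : ∀ i, 0 ≤ weight i
  weight_sum : HasSum weight 1
  norm_vec : ∀ i, ‖vec i‖ = 1

namespace ProbeState

variable {ι : Type*} (σ : ProbeState ι)

/-- The joint distribution of `(Q₁, Q₂)` in the state `σ`. -/
def posLaw : Measure (Conf 2) :=
  Measure.sum fun i => ENNReal.ofReal (σ.weight i) • ArthursKelly.posLaw (σ.vec i)

/-- The joint distribution of `(P₁, P₂)` in the state `σ`. -/
def momLaw : Measure (Conf 2) :=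
  Measure.sum fun i => ENNReal.ofReal (σ.weight i) • ArthursKelly.momLaw (σ.vec i)

/-- `⟨g(Q₁, Q₂)⟩_σ`. -/
def avgQ (g : Conf 2 → ℝ) : ℝ := ∫ x, g x ∂σ.posLaw

/-- `⟨g(P₁, P₂)⟩_σ`. -/
def avgP (g : Conf 2 → ℝ) : ℝ := ∫ p, g p ∂σ.momLaw

/-- `Var(Q_j, σ) = ⟨Q_j²⟩ - ⟨Q_j⟩²`. -/
def varQ (j : Fin 2) : ℝ := σ.avgQ (fun x => x j ^ 2) - σ.avgQ (fun x => x j) ^ 2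

/-- `Var(P_j, σ) = ⟨P_j²⟩ - ⟨P_j⟩²`. -/
def varP (j : Fin 2) : ℝ := σ.avgP (fun p => p j ^ 2) - σ.avgP (fun p => p j) ^ 2

/-- `Cov(Q₁, Q₂, σ) = ⟨Q₁ Q₂⟩ - ⟨Q₁⟩⟨Q₂⟩`. -/
def covQ : ℝ := σ.avgQ (fun x => x 0 * x 1) - σ.avgQ (fun x => x 0) * σ.avgQ (fun x => x 1)

/-- `Cov(P₁, P₂, σ) = ⟨P₁ P₂⟩ - ⟨P₁⟩⟨P₂⟩`. -/
def covP : ℝ := σ.avgP (fun p => p 0 * p 1) - σ.avgP (fun p => p 0) * σ.avgP (fun p => p 1)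

/-- `Q₁` and `Q₂` have finite first absolute moments. -/
def FirstMomentsQ : Prop := ∀ j : Fin 2, Integrable (fun x : Conf 2 => x j) σ.posLaw

/-- `P₁` and `P₂` have finite first absolute moments. -/
def FirstMomentsP : Prop := ∀ j : Fin 2, Integrable (fun p : Conf 2 => p j) σ.momLaw

/-- `Q₁` and `Q₂` have finite second moments. -/
def SecondMomentsQ : Prop := ∀ j : Fin 2, Integrable (fun x : Conf 2 => x j ^ 2) σ.posLaw

/-- `P₁` and `P₂` have finite second moments. -/
def SecondMomentsP : Prop := ∀ j : Fin 2, Integrable (fun p : Conf 2 => p j ^ 2) σ.momLaw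

end ProbeState

/-! ### The effective observables -/

/-- The splitting `(q, q₁, q₂) ↦ (q, (q₁, q₂))`. -/
def split (x : Conf 3) : ℝ × Conf 2 := (x 0, !₂[x 1, x 2])

theorem measurePreserving_split : MeasurePreserving split volume volume := by
  have h1 := PiLp.volume_preserving_ofLp (Fin 3)
  have h2 := volume_preserving_piFinSuccAbove (fun _ : Fin 3 => ℝ) 0
  have h3 := (MeasurePreserving.id (volume : Measure ℝ)).prod (PiLp.volume_preserving_toLp (Fin 2))
  have h := h3.comp (h2.comp h1)
  have he : split = Prod.map id (WithLp.toLp 2) ∘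
      ⇑(MeasurableEquiv.piFinSuccAbove (fun _ : Fin 3 => ℝ) 0) ∘ WithLp.ofLp := by
    funext x
    refine Prod.ext rfl ?_
    ext i
    fin_cases i <;> rfl
  rw [he]
  exact h

theorem aesm_prod (ψ : L2 ℝ) (φ : L2 (Conf 2)) :
    AEStronglyMeasurable (fun y : ℝ × Conf 2 => ψ y.1 * φ y.2) (volume.prod volume) :=
  (Lp.aestronglyMeasurable ψ).comp_fst.mul (Lp.aestronglyMeasurable φ).comp_snd

theorem eLpNorm_prod (ψ : L2 ℝ) (φ : L2 (Conf 2)) :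
    eLpNorm (fun y : ℝ × Conf 2 => ψ y.1 * φ y.2) 2 (volume.prod volume)
      = eLpNorm ψ 2 volume * eLpNorm φ 2 volume := by
  have h0 : (0 : ℝ) ≤ (2 : ℝ≥0∞).toReal := ENNReal.toReal_nonneg
  have key := lintegral_prod_mul (μ := (volume : Measure ℝ)) (ν := (volume : Measure (Conf 2)))
    ((Lp.aestronglyMeasurable ψ).enorm.pow_const (2 : ℝ≥0∞).toReal)
    ((Lp.aestronglyMeasurable φ).enorm.pow_const (2 : ℝ≥0∞).toReal)
  rw [eLpNorm_eq_lintegral_rpow_enorm_toReal two_ne_zero ENNReal.ofNat_ne_top,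
    eLpNorm_eq_lintegral_rpow_enorm_toReal two_ne_zero ENNReal.ofNat_ne_top,
    eLpNorm_eq_lintegral_rpow_enorm_toReal two_ne_zero ENNReal.ofNat_ne_top,
    ← ENNReal.mul_rpow_of_nonneg _ _ (by positivity), ← key]
  simp only [enorm_mul, ENNReal.mul_rpow_of_nonneg _ _ h0]

theorem eLpNorm_tensor (ψ : L2 ℝ) (φ : L2 (Conf 2)) :
    eLpNorm (fun x : Conf 3 => ψ (x 0) * φ !₂[x 1, x 2]) 2 volume
      = eLpNorm ψ 2 volume * eLpNorm φ 2 volume :=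
  (eLpNorm_comp_measurePreserving (aesm_prod ψ φ) measurePreserving_split).trans (eLpNorm_prod ψ φ)

theorem memLp_tensor (ψ : L2 ℝ) (φ : L2 (Conf 2)) :
    MemLp (fun x : Conf 3 => ψ (x 0) * φ !₂[x 1, x 2]) 2 volume := by
  refine ⟨(aesm_prod ψ φ).comp_measurePreserving measurePreserving_split, ?_⟩
  rw [eLpNorm_tensor]
  exact ENNReal.mul_lt_top (Lp.eLpNorm_lt_top ψ) (Lp.eLpNorm_lt_top φ)

/-- The vector `ψ ⊗ φ`, i.e. the function `(q, q₁, q₂) ↦ ψ(q) φ(q₁, q₂)`. -/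
def tensor (ψ : L2 ℝ) (φ : L2 (Conf 2)) : L2 (Conf 3) := (memLp_tensor ψ φ).toLp _

theorem ae_comp_fst {p : ℝ → Prop} (h : ∀ᵐ y, p y) : ∀ᵐ x : Conf 3, p (x 0) :=
  (Measure.quasiMeasurePreserving_fst.comp
    measurePreserving_split.quasiMeasurePreserving).ae h

/-- The bounded operator `ψ ↦ ψ ⊗ φ`. -/
def tensorL (φ : L2 (Conf 2)) : L2 ℝ →L[ℂ] L2 (Conf 3) :=
  LinearMap.mkContinuous
    { toFun := fun ψ => tensor ψ φ
      map_add' := fun ψ χ => by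
        unfold tensor
        rw [← MemLp.toLp_add]
        refine MemLp.toLp_congr _ _ ?_
        filter_upwards [ae_comp_fst (Lp.coeFn_add ψ χ)] with x hx
        rw [hx]; exact add_mul _ _ _
      map_smul' := fun c ψ => by
        unfold tensor
        rw [RingHom.id_apply, ← MemLp.toLp_const_smul]
        refine MemLp.toLp_congr _ _ ?_
        filter_upwards [ae_comp_fst (Lp.coeFn_smul c ψ)] with x hx
        rw [hx]; exact mul_assoc _ _ _ }
    ‖φ‖ (fun ψ => by
      change ‖tensor ψ φ‖ ≤ _
      rw [tensor, Lp.norm_toLp, eLpNorm_tensor, ENNReal.toReal_mul, mul_comm,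
        Lp.norm_def, Lp.norm_def])

/-- The operator `A` on the system with
`⟨ψ, A ψ⟩ = tr[U (|ψ⟩⟨ψ| ⊗ σ) U* M] = ∑ᵢ pᵢ ⟨U (ψ ⊗ φᵢ), M U (ψ ⊗ φᵢ)⟩`:
the effect measured on the system when, after the coupling `U` with probes in the state `σ`,
the effect `M` is measured. -/
def effective {ι : Type*} (U : L2 (Conf 3) ≃ₗᵢ[ℂ] L2 (Conf 3)) (σ : ProbeState ι)
    (M : L2 (Conf 3) →L[ℂ] L2 (Conf 3)) : L2 ℝ →L[ℂ] L2 ℝ :=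
  ∑' i, (σ.weight i : ℂ) •
    (ContinuousLinearMap.adjoint
        (U.toContinuousLinearEquiv.toContinuousLinearMap ∘L tensorL (σ.vec i)) ∘L
      M ∘L (U.toContinuousLinearEquiv.toContinuousLinearMap ∘L tensorL (σ.vec i)))

variable {ι : Type*}

/-- The phase space observable `G(X × Y)`: after the coupling, the position of probe 1 is found in
`lam X` and the momentum of probe 2 in `mu Y`. -/
def obsG (lam mu kap : ℝ) (σ : ProbeState ι) (X Y : Set ℝ) : L2 ℝ →L[ℂ] L2 ℝ :=
  effective (coupling lam mu kap) σ (posProj 1 (lam • X) ∘L momProj 2 (mu • Y))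

/-- The position marginal `E(X) = G(X × ℝ)`. -/
def obsE (lam mu kap : ℝ) (σ : ProbeState ι) (X : Set ℝ) : L2 ℝ →L[ℂ] L2 ℝ :=
  obsG lam mu kap σ X Set.univ

/-- The momentum marginal `F(Y) = G(ℝ × Y)`. -/
def obsF (lam mu kap : ℝ) (σ : ProbeState ι) (Y : Set ℝ) : L2 ℝ →L[ℂ] L2 ℝ :=
  obsG lam mu kap σ Set.univ Y

/-- The observable measured with the first probe alone, at coupling `mu = 0`. -/
def obsE0 (lam kap : ℝ) (σ : ProbeState ι) (X : Set ℝ) : L2 ℝ →L[ℂ] L2 ℝ :=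
  effective (coupling lam 0 kap) σ (posProj 1 (lam • X))

/-- The observable measured with the second probe alone, at coupling `lam = 0`. -/
def obsF0 (mu kap : ℝ) (σ : ProbeState ι) (Y : Set ℝ) : L2 ℝ →L[ℂ] L2 ℝ :=
  effective (coupling 0 mu kap) σ (momProj 2 (mu • Y))

/-! ### The noise densities -/

/-- The density `e` of the position noise. -/
def noiseE (lam mu kap : ℝ) (σ : ProbeState ι) (q : ℝ) : ℝ :=
  lam / mu * ∑' i, σ.weight i *
    ∫ q' : ℝ, ‖σ.vec i !₂[lam * ((1 - kap) / 2 * q' - q), q' / mu]‖ ^ 2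

/-- The density `f` of the momentum noise. -/
def noiseF (lam mu kap : ℝ) (σ : ProbeState ι) (p : ℝ) : ℝ :=
  mu / lam * ∑' i, σ.weight i *
    ∫ w : ℝ, ‖momWave (σ.vec i) !₂[w / lam, mu * (w / 2 * (kap + 1) - p)]‖ ^ 2

/-- The density of the position noise for the first probe alone. -/
def noiseE0 (lam : ℝ) (σ : ProbeState ι) (q : ℝ) : ℝ :=
  lam * ∑' i, σ.weight i * ∫ q₂ : ℝ, ‖σ.vec i !₂[-(lam * q), q₂]‖ ^ 2

/-- The density of the momentum noise for the second probe alone. -/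
def noiseF0 (mu : ℝ) (σ : ProbeState ι) (p : ℝ) : ℝ :=
  mu * ∑' i, σ.weight i * ∫ p₁ : ℝ, ‖momWave (σ.vec i) !₂[p₁, -(mu * p)]‖ ^ 2

/-- `e` is a probability density on `ℝ`. -/
def IsProbDensity (e : ℝ → ℝ) : Prop := (∀ q, 0 ≤ e q) ∧ Integrable e ∧ ∫ q, e q = 1

/-- The smeared indicator function `χ_X * e`. -/
def smear (X : Set ℝ) (e : ℝ → ℝ) : ℝ → ℝ :=
  X.indicator (fun _ => (1 : ℝ)) ⋆[ContinuousLinearMap.mul ℝ ℝ, volume] e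

/-- The first moment `e[1]`. -/
def moment1 (e : ℝ → ℝ) : ℝ := ∫ q, q * e q

/-- The second moment `e[2]`. -/
def moment2 (e : ℝ → ℝ) : ℝ := ∫ q, q ^ 2 * e q

/-- The variance of the probability density `e`. -/
def densityVar (e : ℝ → ℝ) : ℝ := ∫ q, (q - moment1 e) ^ 2 * e q

/-! ### Measurement statistics and Di Lorenzo's quantities -/

/-- `ν` is the outcome distribution of the observable `A` in the vector state `ψ`:
`ν(X) = ⟨ψ, A(X) ψ⟩`. -/
def IsOutcomeLaw (A : Set ℝ → (L2 ℝ →L[ℂ] L2 ℝ)) (ψ : L2 ℝ) (ν : Measure ℝ) : Prop :=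
  IsProbabilityMeasure ν ∧ ∀ X, MeasurableSet X → ((ν.real X : ℝ) : ℂ) = inner ℂ ψ (A X ψ)

/-- The outcome distribution of the observable `A` in the vector state `ψ`. -/
def outcomeLaw (A : Set ℝ → (L2 ℝ →L[ℂ] L2 ℝ)) (ψ : L2 ℝ) : Measure ℝ :=
  Classical.epsilon (IsOutcomeLaw A ψ)

/-- The statement that the outcomes of `A` in the state `ψ` have a distribution, with finite second
moment. -/
def HasFiniteVar (A : Set ℝ → (L2 ℝ →L[ℂ] L2 ℝ)) (ψ : L2 ℝ) : Prop :=
  (∃! ν, IsOutcomeLaw A ψ ν) ∧ Integrable (fun x => x ^ 2) (outcomeLaw A ψ)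

/-- `Var(A, ψ)`, the variance of the outcomes of `A` in the state `ψ`. -/
def obsVar (A : Set ℝ → (L2 ℝ →L[ℂ] L2 ℝ)) (ψ : L2 ℝ) : ℝ :=
  ∫ x, (x - ∫ y, y ∂outcomeLaw A ψ) ^ 2 ∂outcomeLaw A ψ

/-- Di Lorenzo's quantity `Δ_DL(Q)` in the system state `ψ`. -/
def deltaQ (lam mu kap : ℝ) (σ : ProbeState ι) (ψ : L2 ℝ) : ℝ :=
  obsVar (obsE lam mu kap σ) ψ - obsVar (obsE0 lam kap σ) ψ

/-- Di Lorenzo's quantity `Δ_DL(P)` in the system state `ψ`. -/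
def deltaP (lam mu kap : ℝ) (σ : ProbeState ι) (ψ : L2 ℝ) : ℝ :=
  obsVar (obsF lam mu kap σ) ψ - obsVar (obsF0 mu kap σ) ψ

end

end ArthursKelly

open ArthursKelly

/-!
`-i` times the Hamiltonian is the derivation `f ↦ ∂_{Ax} f` along a nilpotent linear vector field
`A` on configuration space, so `exp(-itH)` is composition with the linear flow `exp(tA)`, which
preserves volume, and in the momentum representation it is composition with the flow of `-A*`.
Hence, for `λμ ≠ 0`, the pointer readings `Q₁/λ` and `P₂/μ` after the coupling are distributed like
`Q - N` and `P - M`, where `N` and `M` are linear combinations of the probe positions and of the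
probe momenta, independent of the system. The marginals are therefore the spectral measures of `Q`
and `P` smeared with the laws of `N` and `M`, and variances add: Di Lorenzo's quantities do not
depend on the system state and equal the differences of the variances of the noises.

Mixing the two opposite displacements of a probe state by `±v` keeps its mean and adds `v_j v_k` to
its covariance matrix. With `v_j = 1`, the choice of `v_k` gives the covariance any value at a fixed
variance of the `j`-th variable. Displacements in position and in momentum are
independent of each other, so both disturbances can be made negative at once.
-/

namespace ArthursKelly

open ProbabilityTheory

noncomputable section
/-! ### Dominated convergence and differentiation in `Lᵖ` -/

section Dominated

variable {α ι F : Type*} [MeasurableSpace α] {μ : Measure α} [NormedAddCommGroup F]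
  {p : ℝ≥0∞} [Fact (1 ≤ p)]

theorem tendsto_toLp_of_dominated (hp : p ≠ ∞) {l : Filter ι} [l.IsCountablyGenerated]
    {f : ι → α → F} {g : α → F} (hf : ∀ i, MemLp (f i) p μ) (hg : MemLp g p μ)
    {bound : α → ℝ} (h_bound_memLp : MemLp bound p μ)
    (h_bound : ∀ᶠ i in l, ∀ x, ‖f i x‖ ≤ bound x)
    (h_lim : ∀ x, Filter.Tendsto (fun i => f i x) l (nhds (g x))) :
    Filter.Tendsto (fun i => (hf i).toLp (f i)) l (nhds (hg.toLp g)) := by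
  have hp₀ : p ≠ 0 := (zero_lt_one.trans_le (Fact.out : 1 ≤ p)).ne'
  have hr : 0 < p.toReal := ENNReal.toReal_pos hp₀ hp
  have h_lintegral : Filter.Tendsto (fun i => ∫⁻ x, ‖f i x - g x‖ₑ ^ p.toReal ∂μ) l
      (nhds (∫⁻ _, 0 ∂μ)) := by
    refine tendsto_lintegral_filter_of_dominated_convergence'
      (fun x => ‖bound x + ‖g x‖‖ₑ ^ p.toReal)
      (.of_forall fun i => ((hf i).1.sub hg.1).enorm.pow_const _) ?_
      (lintegral_rpow_enorm_lt_top_of_eLpNorm_lt_top hp₀ hp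
        (h_bound_memLp.add hg.norm).eLpNorm_lt_top).ne (.of_forall fun x => ?_)
    · filter_upwards [h_bound] with i hi
      refine .of_forall fun x => ENNReal.rpow_le_rpow ?_ hr.le
      rw [enorm_le_iff_norm_le]
      calc ‖f i x - g x‖ ≤ ‖f i x‖ + ‖g x‖ := norm_sub_le _ _
        _ ≤ bound x + ‖g x‖ := by gcongr; exact hi x
        _ ≤ ‖bound x + ‖g x‖‖ := Real.le_norm_self _
    · have h_enorm : Filter.Tendsto (fun i => ‖f i x - g x‖ₑ) l (nhds 0) := by
        simpa using ((h_lim x).sub_const (g x)).enorm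
      simpa [ENNReal.zero_rpow_of_pos hr] using h_enorm.ennrpow_const p.toReal
  rw [Lp.tendsto_Lp_iff_tendsto_eLpNorm'']
  simp only [eLpNorm_eq_lintegral_rpow_enorm_toReal hp₀ hp]
  simpa [ENNReal.zero_rpow_of_pos (inv_pos.2 hr)] using h_lintegral.ennrpow_const (1 / p.toReal)

theorem hasDerivAt_toLp_of_dominated_of_deriv_le [NormedSpace ℝ F] (hp : p ≠ ∞)
    {f f' : ℝ → α → F} {t₀ ε : ℝ} (hε : 0 < ε) (hf : ∀ t, MemLp (f t) p μ)
    (hf' : MemLp (f' t₀) p μ) {bound : α → ℝ} (h_bound_memLp : MemLp bound p μ)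
    (h_bound : ∀ t ∈ Metric.ball t₀ ε, ∀ x, ‖f' t x‖ ≤ bound x)
    (h_deriv : ∀ t ∈ Metric.ball t₀ ε, ∀ x, HasDerivAt (fun s => f s x) (f' t x) t) :
    HasDerivAt (fun t => (hf t).toLp (f t)) (hf'.toLp (f' t₀)) t₀ := by
  have h_slope_memLp (t : ℝ) : MemLp (t⁻¹ • (f (t₀ + t) - f t₀)) p μ :=
    ((hf (t₀ + t)).sub (hf t₀)).const_smul t⁻¹
  have h_slope_bound : ∀ᶠ t : ℝ in nhdsWithin 0 {0}ᶜ, ∀ x,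
      ‖(t⁻¹ • (f (t₀ + t) - f t₀)) x‖ ≤ bound x := by
    filter_upwards [nhdsWithin_le_nhds (Metric.ball_mem_nhds (0 : ℝ) hε), self_mem_nhdsWithin]
      with t ht ht0 x
    have h_mean_value := Convex.norm_image_sub_le_of_norm_hasDerivWithin_le
      (fun s hs => (h_deriv s hs x).hasDerivWithinAt) (fun s hs => h_bound s hs x)
      (convex_ball t₀ ε) (Metric.mem_ball_self hε) (y := t₀ + t) (by simpa using ht)
    rw [Pi.smul_apply, Pi.sub_apply, norm_smul, norm_inv, inv_mul_le_iff₀ (norm_pos_iff.2 ht0)]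
    simpa [mul_comm] using h_mean_value
  have h_slope_lim (x : α) := hasDerivAt_iff_tendsto_slope_zero.1
    (h_deriv t₀ (Metric.mem_ball_self hε) x)
  rw [hasDerivAt_iff_tendsto_slope_zero]
  refine (tendsto_toLp_of_dominated hp h_slope_memLp hf' h_bound_memLp h_slope_bound
    h_slope_lim).congr fun t => ?_
  rw [MemLp.toLp_const_smul t⁻¹ ((hf (t₀ + t)).sub (hf t₀)), MemLp.toLp_sub (hf (t₀ + t)) (hf t₀)]

end Dominated

theorem memLp_one_add_norm_rpow {E : Type*} [NormedAddCommGroup E] [NormedSpace ℝ E]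
    [FiniteDimensional ℝ E] [MeasurableSpace E] [BorelSpace E] (μ : Measure E)
    [μ.IsAddHaarMeasure] {p : ℝ≥0∞} (hp₀ : p ≠ 0) (hp : p ≠ ∞) {r : ℝ}
    (hr : Module.finrank ℝ E < r * p.toReal) :
    MemLp (fun x : E => (1 + ‖x‖) ^ (-r)) p μ := by
  have hc : Continuous fun x : E => (1 + ‖x‖) ^ (-r) :=
    Continuous.rpow_const (by fun_prop) fun x => Or.inl (by positivity)
  rw [← integrable_norm_rpow_iff hc.aestronglyMeasurable hp₀ hp]
  refine (integrable_one_add_norm (μ := μ) hr).congr (.of_forall fun x => ?_)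
  beta_reduce
  rw [Real.norm_of_nonneg (by positivity), ← Real.rpow_mul (by positivity), neg_mul]

/-! ### Linear flows -/

section ExpFlow

variable {E : Type*} [NormedAddCommGroup E] [NormedSpace ℝ E]

theorem exp_eq_sum_of_pow_eq_zero {A : E →L[ℝ] E} {k : ℕ} (hA : A ^ k = 0) :
    NormedSpace.exp A = ∑ n ∈ Finset.range k, (n.factorial : ℝ)⁻¹ • A ^ n := by
  rw [NormedSpace.exp_eq_tsum ℝ]
  refine tsum_eq_sum fun n hn => ?_
  rw [pow_eq_zero_of_le (not_lt.1 (Finset.mem_range.not.1 hn)) hA, smul_zero]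

theorem isNilpotent_exp_sub_one {A : E →L[ℝ] E} (hA : IsNilpotent A) :
    IsNilpotent (NormedSpace.exp A - 1) := by
  obtain ⟨k, hk⟩ := hA
  rw [exp_eq_sum_of_pow_eq_zero (k := k + 1) (by rw [pow_succ, hk, zero_mul]),
    Finset.sum_range_succ']
  simp only [Nat.factorial_zero, Nat.cast_one, inv_one, pow_zero, one_smul, add_sub_cancel_right]
  refine Commute.isNilpotent_sum (fun n _ => ?_) fun m n _ _ => ?_
  · exact (IsNilpotent.pow_of_pos ⟨k, hk⟩ n.succ_ne_zero).smul _
  · exact (((Commute.refl A).pow_pow _ _).smul_left _).smul_right _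

variable [CompleteSpace E]

theorem exp_neg_mul_exp (A : E →L[ℝ] E) : NormedSpace.exp (-A) * NormedSpace.exp A = 1 := by
  let := NormedAlgebra.restrictScalars ℚ ℝ (E →L[ℝ] E)
  rw [← NormedSpace.exp_add_of_commute (Commute.refl A).neg_left, neg_add_cancel,
    NormedSpace.exp_zero]

/-- The flow `t ↦ exp (t A)` of the linear vector field `A`. -/
def expFlow (A : E →L[ℝ] E) (t : ℝ) : E ≃L[ℝ] E :=
  ContinuousLinearEquiv.equivOfInverse (NormedSpace.exp (t • A)) (NormedSpace.exp (-(t • A)))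
    (fun x => DFunLike.congr_fun (exp_neg_mul_exp (t • A)) x)
    (fun x => by simpa using DFunLike.congr_fun (exp_neg_mul_exp (-(t • A))) x)

theorem coe_expFlow (A : E →L[ℝ] E) (t : ℝ) :
    (expFlow A t : E →L[ℝ] E) = NormedSpace.exp (t • A) := rfl

theorem expFlow_zero (A : E →L[ℝ] E) (x : E) : expFlow A 0 x = x := by
  change NormedSpace.exp ((0 : ℝ) • A) x = x
  rw [zero_smul, NormedSpace.exp_zero, one_apply_eq_self]

theorem expFlow_add (A : E →L[ℝ] E) (s t : ℝ) (x : E) :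
    expFlow A (s + t) x = expFlow A s (expFlow A t x) := by
  let := NormedAlgebra.restrictScalars ℚ ℝ (E →L[ℝ] E)
  change NormedSpace.exp ((s + t) • A) x = NormedSpace.exp (s • A) (NormedSpace.exp (t • A) x)
  rw [add_smul, NormedSpace.exp_add_of_commute (((Commute.refl A).smul_left s).smul_right t)]
  rfl

theorem hasDerivAt_expFlow (A : E →L[ℝ] E) (t : ℝ) :
    HasDerivAt (fun s => (expFlow A s : E →L[ℝ] E)) (A * (expFlow A t : E →L[ℝ] E)) t :=
  hasDerivAt_exp_smul_const' A t

theorem hasDerivAt_expFlow_apply (A : E →L[ℝ] E) (t : ℝ) (x : E) :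
    HasDerivAt (fun s => expFlow A s x) (A (expFlow A t x)) t :=
  ((ContinuousLinearMap.apply ℝ E x).hasFDerivAt.comp_hasDerivAt t (hasDerivAt_expFlow A t) :)

theorem continuous_coe_expFlow (A : E →L[ℝ] E) :
    Continuous fun t => (expFlow A t : E →L[ℝ] E) :=
  continuous_iff_continuousAt.2 fun t => (hasDerivAt_expFlow A t).continuousAt

theorem continuous_uncurry_expFlow (A : E →L[ℝ] E) :
    Continuous fun y : ℝ × E => expFlow A y.1 y.2 :=
  ((continuous_coe_expFlow A).comp continuous_fst).clm_apply continuous_snd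

theorem exists_norm_expFlow_le (A : E →L[ℝ] E) :
    ∃ M : ℝ, 1 ≤ M ∧ ∀ t : ℝ, |t| ≤ 1 → ∀ x, ‖expFlow A t x‖ ≤ M * ‖x‖ := by
  obtain ⟨M, hM⟩ := (isCompact_Icc (a := (-1 : ℝ)) (b := 1)).exists_bound_of_continuousOn
    (continuous_coe_expFlow A).continuousOn
  exact ⟨max M 1, le_max_right _ _, fun t ht x =>
    (expFlow A t : E →L[ℝ] E).le_of_opNorm_le ((hM t (abs_le.1 ht)).trans (le_max_left _ _)) x⟩

theorem expFlow_apply_of_pow_three_eq_zero {A : E →L[ℝ] E} (hA : A ^ 3 = 0) (t : ℝ) (x : E) :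
    expFlow A t x = x + t • A x + (t ^ 2 / 2) • A (A x) := by
  change NormedSpace.exp (t • A) x = _
  rw [exp_eq_sum_of_pow_eq_zero (k := 3) (by rw [smul_pow, hA, smul_zero])]
  simp only [Finset.sum_range_succ, Finset.range_one, Finset.sum_singleton, Nat.factorial_zero,
    Nat.cast_one, inv_one, pow_zero, one_smul, Nat.factorial_one, pow_one, smul_smul, one_mul,
    Nat.factorial_two, Nat.cast_ofNat, pow_two, Algebra.mul_smul_comm, Algebra.smul_mul_assoc,
    add_apply, one_apply_eq_self, smul_apply, mul_apply_eq_comp, add_right_inj]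
  ring_nf

end ExpFlow

theorem det_one_add_of_isNilpotent {R M : Type*} [CommRing R] [IsDomain R] [AddCommGroup M]
    [Module R M] [Module.Free R M] [Module.Finite R M] {N : Module.End R M}
    (hN : IsNilpotent N) : LinearMap.det (1 + N) = 1 := by
  have h := LinearMap.eval_charpoly (-N) 1
  rw [IsNilpotent.charpoly_eq_X_pow_finrank hN.neg] at h
  simpa using h.symm

section MeasurePreservingFlow

variable {E : Type*} [NormedAddCommGroup E] [NormedSpace ℝ E] [FiniteDimensional ℝ E]
  [MeasurableSpace E] [BorelSpace E] (μ : Measure E) [μ.IsAddHaarMeasure]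

theorem measurePreserving_of_isNilpotent_sub_one {B : E →L[ℝ] E} (hB : IsNilpotent (B - 1)) :
    MeasurePreserving B μ μ := by
  have hdet : LinearMap.det (B : E →ₗ[ℝ] E) = 1 := by
    have h := det_one_add_of_isNilpotent (hB.map ContinuousLinearMap.toLinearMapRingHom)
    simpa using h
  refine ⟨B.continuous.measurable, ?_⟩
  have h := Measure.map_linearMap_addHaar_eq_smul_addHaar μ (f := (B : E →ₗ[ℝ] E))
    (by rw [hdet]; exact one_ne_zero)
  simpa [hdet] using h

theorem measurePreserving_expFlow {A : E →L[ℝ] E} (hA : IsNilpotent A) (t : ℝ) :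
    MeasurePreserving (expFlow A t) μ μ :=
  measurePreserving_of_isNilpotent_sub_one μ (isNilpotent_exp_sub_one (hA.smul t))

end MeasurePreservingFlow

/-! ### One-parameter unitary groups -/

section OneParameterGroup

variable {G : Type*} [NormedAddCommGroup G] [NormedSpace ℂ G]

theorem unitary_mul_apply (V W : G ≃ₗᵢ[ℂ] G) (ψ : G) : (V * W) ψ = V (W ψ) := rfl

theorem group_apply_neg_apply {W : ℝ → (G ≃ₗᵢ[ℂ] G)} (hW : ∀ s t, W (s + t) = W s * W t)
    (t : ℝ) (ψ : G) : W t (W (-t) ψ) = ψ := by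
  have hW0 : W 0 = 1 := by simpa using hW 0 0
  rw [← unitary_mul_apply, ← hW, add_neg_cancel, hW0, LinearIsometryEquiv.coe_one,
    id_eq]

variable {V W : ℝ → (G ≃ₗᵢ[ℂ] G)} (hV : ∀ s t, V (s + t) = V s * V t)
  (hW : ∀ s t, W (s + t) = W s * W t)

include hV hW

theorem hasDerivAt_group_neg_apply_group_zero {ψ d : G}
    (hVd : HasDerivAt (fun t => V t ψ) d 0) (hWd : HasDerivAt (fun t => W t ψ) d 0) :
    HasDerivAt (fun t => W (-t) (V t ψ)) 0 0 := by
  have hV0 : V 0 = 1 := by simpa using hV 0 0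
  have hW0 : W 0 = 1 := by simpa using hW 0 0
  have h_sub := hVd.sub hWd
  rw [sub_self, hasDerivAt_iff_tendsto] at h_sub
  rw [hasDerivAt_iff_tendsto]
  refine h_sub.congr fun t => ?_
  simp only [Pi.sub_apply, hV0, hW0, smul_zero, sub_zero, LinearIsometryEquiv.coe_one, id_eq,
    sub_self, neg_zero]
  rw [← (W t).norm_map (W (-t) _ - _), map_sub, group_apply_neg_apply hW]

theorem hasDerivAt_group_neg_apply_group {ψ d : G} {s : ℝ}
    (hVd : HasDerivAt (fun t => V t (V s ψ)) d 0) (hWd : HasDerivAt (fun t => W t (V s ψ)) d 0) :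
    HasDerivAt (fun t => W (-t) (V t ψ)) 0 s := by
  have h_zero : HasDerivAt (fun t => W (-t) (V t (V s ψ))) 0 (s - s) := by
    rw [sub_self]
    exact hasDerivAt_group_neg_apply_group_zero hV hW hVd hWd
  have h_shift := ((W (-s)).toContinuousLinearEquiv.toContinuousLinearMap.restrictScalars
    ℝ).hasFDerivAt.comp_hasDerivAt s (h_zero.comp_sub_const s s)
  rw [map_zero] at h_shift
  refine h_shift.congr_of_eventuallyEq (.of_forall fun t => ?_)
  change W (-t) (V t ψ) = W (-s) (W (-(t - s)) (V (t - s) (V s ψ)))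
  rw [← unitary_mul_apply (V _), ← hV, sub_add_cancel,
    ← unitary_mul_apply (W _) (W _), ← hW, show -s + -(t - s) = -t by ring]

theorem group_eq_of_hasDerivAt_zero {D : Set G} (hD : Dense D)
    (hVD : ∀ t, ∀ ψ ∈ D, V t ψ ∈ D)
    (h_gen : ∀ ψ ∈ D, ∃ d, HasDerivAt (fun t => V t ψ) d 0 ∧ HasDerivAt (fun t => W t ψ) d 0)
    (t : ℝ) : V t = W t := by
  have hV0 : V 0 = 1 := by simpa using hV 0 0
  have hW0 : W 0 = 1 := by simpa using hW 0 0
  have h_const (ψ) (hψ : ψ ∈ D) : W (-t) (V t ψ) = ψ := by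
    have h_deriv (s : ℝ) : HasDerivAt (fun t => W (-t) (V t ψ)) 0 s := by
      obtain ⟨d, hVd, hWd⟩ := h_gen _ (hVD s ψ hψ)
      exact hasDerivAt_group_neg_apply_group hV hW hVd hWd
    simpa [hV0, hW0] using is_const_of_deriv_eq_zero (fun s => (h_deriv s).differentiableAt)
      (fun s => (h_deriv s).deriv) t 0
  refine LinearIsometryEquiv.ext fun ψ => congrFun ((V t).continuous.ext_on hD (W t).continuous
    fun ψ hψ => ?_) ψ
  rw [← group_apply_neg_apply hW t (V t ψ), h_const ψ hψ]

end OneParameterGroup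

/-! ### The unitary group of a nilpotent linear flow -/

theorem exists_norm_schwartz_comp_expFlow_le {E : Type*} [NormedAddCommGroup E] [NormedSpace ℝ E]
    [CompleteSpace E] (A : E →L[ℝ] E) (g : 𝓢(E, ℂ)) (k : ℕ) :
    ∃ C : ℝ, ∀ t : ℝ, |t| ≤ 1 → ∀ x, ‖g (expFlow A t x)‖ ≤ C * (1 + ‖x‖) ^ (-k : ℝ) := by
  obtain ⟨M, hM1, hM⟩ := exists_norm_expFlow_le A
  obtain ⟨C, hC⟩ : ∃ C : ℝ, ∀ y, (1 + ‖y‖) ^ k * ‖g y‖ ≤ C := by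
    refine ⟨2 ^ k * ((Finset.Iic (k, 0)).sup fun m => SchwartzMap.seminorm ℝ m.1 m.2) g,
      fun y => ?_⟩
    simpa using SchwartzMap.one_add_le_sup_seminorm_apply (𝕜 := ℝ) (m := (k, 0)) le_rfl le_rfl g y
  refine ⟨M ^ k * C, fun t ht x => ?_⟩
  have h_norm : ‖x‖ ≤ M * ‖expFlow A t x‖ := by
    simpa [← expFlow_add, expFlow_zero] using hM (-t) (by simpa using ht) (expFlow A t x)
  have h_decay : (1 + ‖x‖) ^ k * ‖g (expFlow A t x)‖ ≤ M ^ k * C :=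
    calc (1 + ‖x‖) ^ k * ‖g (expFlow A t x)‖
        ≤ (M * (1 + ‖expFlow A t x‖)) ^ k * ‖g (expFlow A t x)‖ := by gcongr; linarith
      _ = M ^ k * ((1 + ‖expFlow A t x‖) ^ k * ‖g (expFlow A t x)‖) := by rw [mul_pow, mul_assoc]
      _ ≤ M ^ k * C := by gcongr; exact hC _
  rw [Real.rpow_neg (by positivity), Real.rpow_natCast, ← div_eq_mul_inv,
    le_div_iff₀ (by positivity), mul_comm]
  exact h_decay

section CompUnitary

variable {E : Type*} [NormedAddCommGroup E] [InnerProductSpace ℝ E] [FiniteDimensional ℝ E]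
  [MeasurableSpace E] [BorelSpace E]

/-- The unitary `ψ ↦ ψ ∘ B` on `L²(E)` of a volume-preserving linear automorphism `B`. -/
def compUnitary (B : E ≃L[ℝ] E) (hB : MeasurePreserving B volume volume) :
    L2 E ≃ₗᵢ[ℂ] L2 E :=
  have hB' : MeasurePreserving B.symm volume volume :=
    hB.symm B.toHomeomorph.toMeasurableEquiv
  { Lp.compMeasurePreservingₗᵢ ℂ B hB with
    invFun := Lp.compMeasurePreserving B.symm hB'
    left_inv := fun ψ => by
      change Lp.compMeasurePreserving _ hB' (Lp.compMeasurePreserving _ hB ψ) = ψ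
      rw [← Lp.compMeasurePreserving_comp_apply]
      convert Lp.compMeasurePreserving_id_apply ψ
      exact B.self_comp_symm
    right_inv := fun ψ => by
      change Lp.compMeasurePreserving _ hB (Lp.compMeasurePreserving _ hB' ψ) = ψ
      rw [← Lp.compMeasurePreserving_comp_apply]
      convert Lp.compMeasurePreserving_id_apply ψ
      exact B.symm_comp_self }

theorem compUnitary_apply {B : E ≃L[ℝ] E} (hB : MeasurePreserving B volume volume) (ψ : L2 E) :
    compUnitary B hB ψ = Lp.compMeasurePreserving B hB ψ := rfl

theorem coeFn_compUnitary {B : E ≃L[ℝ] E} (hB : MeasurePreserving B volume volume) (ψ : L2 E) :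
    compUnitary B hB ψ =ᵐ[volume] ψ ∘ B :=
  Lp.coeFn_compMeasurePreserving ψ hB

theorem compUnitary_toLp {B : E ≃L[ℝ] E} (hB : MeasurePreserving B volume volume)
    (f : 𝓢(E, ℂ)) : compUnitary B hB (f.toLp 2 volume)
      = (SchwartzMap.compCLMOfContinuousLinearEquiv ℂ B f).toLp 2 volume := rfl

variable {A : E →L[ℝ] E} (hA : IsNilpotent A)

/-- The one-parameter unitary group `ψ ↦ ψ ∘ exp (t A)` on `L²(E)` of a nilpotent `A`;
nilpotency makes the flow volume-preserving. -/
def flowUnitary (t : ℝ) : L2 E ≃ₗᵢ[ℂ] L2 E :=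
  compUnitary (expFlow A t) (measurePreserving_expFlow volume hA t)

theorem flowUnitary_add (s t : ℝ) :
    flowUnitary hA (s + t) = flowUnitary hA s * flowUnitary hA t := by
  ext1 ψ
  simp only [unitary_mul_apply, flowUnitary, compUnitary_apply]
  rw [← Lp.compMeasurePreserving_comp_apply]
  congr 2
  funext x
  rw [Function.comp_apply, add_comm, expFlow_add]

theorem continuous_flowUnitary (ψ : L2 E) : Continuous fun t => flowUnitary hA t ψ := by
  let g : C(ℝ, C(E, E)) := ContinuousMap.curry ⟨_, continuous_uncurry_expFlow A⟩
  exact Continuous.compMeasurePreservingLp (f := fun _ : ℝ => ψ) (g := g) continuous_const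
    g.continuous (measurePreserving_expFlow volume hA) ENNReal.ofNat_ne_top

theorem hasDerivAt_flowUnitary_toLp {f g : 𝓢(E, ℂ)} (hfg : ∀ x, fderiv ℝ f x (A x) = g x) :
    HasDerivAt (fun t => flowUnitary hA t (f.toLp 2 volume)) (g.toLp 2 volume) 0 := by
  obtain ⟨C, hC⟩ := exists_norm_schwartz_comp_expFlow_le A g (Module.finrank ℝ E + 1)
  have h_bound_memLp := memLp_one_add_norm_rpow (volume : Measure E) (p := 2) two_ne_zero
    ENNReal.ofNat_ne_top (r := (Module.finrank ℝ E + 1 : ℕ))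
    (by push_cast; rw [ENNReal.toReal_ofNat]; linarith)
  have h_deriv (t : ℝ) (x : E) : HasDerivAt (fun s => f (expFlow A s x)) (g (expFlow A t x)) t := by
    rw [← hfg]
    exact f.differentiableAt.hasFDerivAt.comp_hasDerivAt t (hasDerivAt_expFlow_apply A t x)
  have h := hasDerivAt_toLp_of_dominated_of_deriv_le (p := 2) (μ := (volume : Measure E))
    ENNReal.ofNat_ne_top
    (f := fun t x => f (expFlow A t x)) (f' := fun t x => g (expFlow A t x)) (t₀ := 0) one_pos
    (fun t => (SchwartzMap.compCLMOfContinuousLinearEquiv ℂ (expFlow A t) f).memLp 2 volume)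
    ((SchwartzMap.compCLMOfContinuousLinearEquiv ℂ (expFlow A 0) g).memLp 2 volume)
    (h_bound_memLp.const_mul C)
    (fun t ht => hC t (by simpa using (Metric.mem_ball.1 ht).le)) (fun t _ => h_deriv t)
  have h_zero : MemLp.toLp (fun x => g (expFlow A 0 x))
      ((SchwartzMap.compCLMOfContinuousLinearEquiv ℂ (expFlow A 0) g).memLp 2 volume)
      = g.toLp 2 volume :=
    MemLp.toLp_congr _ _ (.of_forall fun x => congrArg g (expFlow_zero A x))
  rw [← h_zero]
  exact h

end CompUnitary

section IsExpNegI

variable {n : ℕ} {H : 𝓢(Conf n, ℂ) →L[ℂ] 𝓢(Conf n, ℂ)} {A : Conf n →L[ℝ] Conf n}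
  (hA : IsNilpotent A) (hHA : ∀ (f : 𝓢(Conf n, ℂ)) x, fderiv ℝ f x (A x) = -Complex.I * H f x)

include hA hHA

theorem hasDerivAt_flowUnitary_of_fderiv_eq (f : 𝓢(Conf n, ℂ)) :
    HasDerivAt (fun t => flowUnitary hA t (f.toLp 2 volume))
      ((-Complex.I) • (H f).toLp 2 volume) 0 :=
  hasDerivAt_flowUnitary_toLp hA (g := (-Complex.I) • H f) (hHA f)

theorem isExpNegI_flowUnitary : IsExpNegI H (flowUnitary hA 1) :=
  ⟨flowUnitary hA, flowUnitary_add hA, continuous_flowUnitary hA,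
    hasDerivAt_flowUnitary_of_fderiv_eq hA hHA, rfl⟩

theorem isExpNegI_iff_eq_flowUnitary {U : L2 (Conf n) ≃ₗᵢ[ℂ] L2 (Conf n)} :
    IsExpNegI H U ↔ U = flowUnitary hA 1 := by
  refine ⟨?_, fun h => h ▸ isExpNegI_flowUnitary hA hHA⟩
  rintro ⟨W, hW, -, hWd, rfl⟩
  refine .symm (group_eq_of_hasDerivAt_zero (flowUnitary_add hA) hW
    (D := Set.range fun f : 𝓢(Conf n, ℂ) => f.toLp 2 volume)
    (SchwartzMap.denseRange_toLpCLM (E := Conf n) (F := ℂ) (p := 2) (μ := volume)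
      ENNReal.ofNat_ne_top) ?_ ?_ 1)
  · rintro t _ ⟨f, rfl⟩
    exact ⟨_, (compUnitary_toLp _ f).symm⟩
  · rintro _ ⟨f, rfl⟩
    exact ⟨_, hasDerivAt_flowUnitary_of_fderiv_eq hA hHA f, hWd f⟩

theorem existsUnique_isExpNegI : ∃! U, IsExpNegI H U :=
  ⟨_, isExpNegI_flowUnitary hA hHA, fun _ => (isExpNegI_iff_eq_flowUnitary hA hHA).1⟩

end IsExpNegI

/-! ### The coupling unitary -/

theorem momOp_apply {n : ℕ} (j : Fin n) (f : 𝓢(Conf n, ℂ)) (x : Conf n) :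
    momOp j f x = -Complex.I * fderiv ℝ f x (EuclideanSpace.single j 1) := by
  simp [momOp, SchwartzMap.lineDerivOp_apply_eq_fderiv]

theorem fderiv_posOp_of_ne {n : ℕ} {i j : Fin n} (hij : i ≠ j) (f : 𝓢(Conf n, ℂ)) (x : Conf n) :
    fderiv ℝ (posOp j f) x (EuclideanSpace.single i 1)
      = (x j : ℂ) * fderiv ℝ f x (EuclideanSpace.single i 1) := by
  let L : Conf n →L[ℝ] ℂ := Complex.ofRealCLM.comp (EuclideanSpace.proj j : Conf n →L[ℝ] ℝ)
  have h_eq : ⇑(posOp j f) = ⇑L * ⇑f := funext (posOp_apply j f)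
  rw [h_eq, (L.hasFDerivAt.mul f.differentiableAt.hasFDerivAt).fderiv]
  simp [L, Ne.symm hij]

section Coupling

variable (lam mu kap : ℝ)

/-- The generator `A` of the linear flow on the configuration space of the three particles by which
the coupling acts: `-iH f` is the derivative of `f` along the vector field `x ↦ A x`. -/
def couplingGen : Conf 3 →L[ℝ] Conf 3 :=
  (mu • EuclideanSpace.proj 2 : Conf 3 →L[ℝ] ℝ).smulRight (EuclideanSpace.single 0 1)
    - (lam • EuclideanSpace.proj 0 + (lam * mu / 2 * kap) • EuclideanSpace.proj 2 :
      Conf 3 →L[ℝ] ℝ).smulRight (EuclideanSpace.single 1 1)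

theorem couplingGen_apply (x : Conf 3) : couplingGen lam mu kap x =
    (mu * x 2) • EuclideanSpace.single 0 1
      - (lam * x 0 + lam * mu / 2 * kap * x 2) • EuclideanSpace.single 1 1 := rfl

theorem couplingGen_pow_three : couplingGen lam mu kap ^ 3 = 0 := by
  ext x i
  change couplingGen lam mu kap (couplingGen lam mu kap (couplingGen lam mu kap x)) i = 0
  fin_cases i <;> simp [couplingGen_apply]

theorem isNilpotent_couplingGen : IsNilpotent (couplingGen lam mu kap) :=
  ⟨3, couplingGen_pow_three lam mu kap⟩

theorem adjoint_couplingGen_apply (ξ : Conf 3) :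
    ContinuousLinearMap.adjoint (couplingGen lam mu kap) ξ =
      !₂[-(lam * ξ 1), 0, mu * ξ 0 - lam * mu / 2 * kap * ξ 1] := by
  refine ext_inner_right ℝ fun x => ?_
  rw [ContinuousLinearMap.adjoint_inner_left]
  simp [couplingGen_apply, PiLp.inner_apply, Fin.sum_univ_three]
  ring

theorem fderiv_couplingGen (f : 𝓢(Conf 3, ℂ)) (x : Conf 3) :
    fderiv ℝ f x (couplingGen lam mu kap x) = -Complex.I * hamiltonian lam mu kap f x := by
  simp only [hamiltonian, couplingGen_apply, map_sub, map_smul, smul_apply, add_apply, sub_apply,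
    ContinuousLinearMap.comp_apply, posOp_apply, momOp_apply,
    fderiv_posOp_of_ne (show (0 : Fin 3) ≠ 2 by decide),
    fderiv_posOp_of_ne (show (1 : Fin 3) ≠ 2 by decide), smul_eq_mul, Complex.real_smul]
  push_cast
  linear_combination (-(lam : ℂ) * x 0 * fderiv ℝ f x (EuclideanSpace.single 1 1)
    + mu * x 2 * fderiv ℝ f x (EuclideanSpace.single 0 1)
    - (lam * mu / 2 * kap) * x 2 * fderiv ℝ f x (EuclideanSpace.single 1 1)) * Complex.I_sq

theorem existsUnique_isExpNegI_hamiltonian : ∃! U, IsExpNegI (hamiltonian lam mu kap) U :=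
  existsUnique_isExpNegI (isNilpotent_couplingGen lam mu kap) (fderiv_couplingGen lam mu kap)

theorem coupling_eq_flowUnitary :
    coupling lam mu kap = flowUnitary (isNilpotent_couplingGen lam mu kap) 1 :=
  (isExpNegI_iff_eq_flowUnitary _ (fderiv_couplingGen lam mu kap)).1
    (Classical.epsilon_spec (existsUnique_isExpNegI_hamiltonian lam mu kap).exists)

theorem expFlow_couplingGen_one (x : Conf 3) : expFlow (couplingGen lam mu kap) 1 x =
    !₂[x 0 + mu * x 2, x 1 - lam * x 0 - lam * mu / 2 * (kap + 1) * x 2, x 2] := by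
  rw [expFlow_apply_of_pow_three_eq_zero (couplingGen_pow_three lam mu kap)]
  ext i
  fin_cases i <;> simp [couplingGen_apply]
  ring

theorem expFlow_neg_adjoint_couplingGen_one (ξ : Conf 3) :
    expFlow (-ContinuousLinearMap.adjoint (couplingGen lam mu kap)) 1 ξ =
      !₂[ξ 0 + lam * ξ 1, ξ 1, ξ 2 - mu * ξ 0 + lam * mu / 2 * (kap - 1) * ξ 1] := by
  rw [expFlow_apply_of_pow_three_eq_zero]
  · ext i
    fin_cases i <;> simp [adjoint_couplingGen_apply]
    ring
  · ext x i
    change (-_ : Conf 3 →L[ℝ] Conf 3) ((-_ : Conf 3 →L[ℝ] Conf 3) (-_)) i = 0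
    fin_cases i <;> simp [adjoint_couplingGen_apply]

end Coupling

/-! ### The Fourier transform on `L²` -/

section Adjoint

variable {E : Type*} [NormedAddCommGroup E] [InnerProductSpace ℝ E] [CompleteSpace E]

theorem inner_expFlow_expFlow_neg_adjoint (A : E →L[ℝ] E) (t : ℝ) (x ξ : E) :
    inner ℝ (expFlow A t x) (expFlow (-ContinuousLinearMap.adjoint A) t ξ) = inner ℝ x ξ := by
  have h_adjoint : (expFlow (-ContinuousLinearMap.adjoint A) t : E →L[ℝ] E)
      = ContinuousLinearMap.adjoint (expFlow A (-t) : E →L[ℝ] E) := by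
    rw [coe_expFlow, coe_expFlow, ← ContinuousLinearMap.star_eq_adjoint,
      ← ContinuousLinearMap.star_eq_adjoint, NormedSpace.star_exp, star_smul,
      star_trivial (-t), smul_neg, neg_smul]
  change inner ℝ _ ((expFlow (-ContinuousLinearMap.adjoint A) t : E →L[ℝ] E) ξ) = _
  rw [h_adjoint, ContinuousLinearMap.adjoint_inner_right]
  change inner ℝ (expFlow A (-t) (expFlow A t x)) ξ = _
  rw [← expFlow_add, neg_add_cancel, expFlow_zero]

theorem isNilpotent_neg_adjoint {A : E →L[ℝ] E} (hA : IsNilpotent A) :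
    IsNilpotent (-ContinuousLinearMap.adjoint A) := by
  obtain ⟨k, hk⟩ := hA
  refine IsNilpotent.neg ⟨k, ?_⟩
  rw [← ContinuousLinearMap.star_eq_adjoint, ← star_pow, hk, star_zero]

end Adjoint

section Fourier

variable {E : Type*} [NormedAddCommGroup E] [InnerProductSpace ℝ E] [FiniteDimensional ℝ E]
  [MeasurableSpace E] [BorelSpace E]

theorem integral_smul_fourierTransform_toLp {f : E → ℂ} (hf₁ : Integrable f)
    (hf₂ : MemLp f 2 volume) (g : 𝓢(E, ℂ)) :
    ∫ x, g x • (Lp.fourierTransformₗᵢ E ℂ (hf₂.toLp f) : L2 E) x = ∫ x, g x • 𝓕 f x := by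
  have h_weak := DFunLike.congr_fun (Lp.fourier_toTemperedDistribution_eq (hf₂.toLp f)) g
  rw [TemperedDistribution.fourier_apply, Lp.toTemperedDistribution_apply,
    Lp.toTemperedDistribution_apply] at h_weak
  have h_self_adjoint := VectorFourier.integral_fourierIntegral_smul_eq_flip (L := innerₗ E)
    Real.continuous_fourierChar (by exact continuous_inner) (g.integrable (μ := volume)) hf₁
  rw [flip_innerₗ] at h_self_adjoint
  refine .trans h_weak.symm (.trans (integral_congr_ae ?_) h_self_adjoint)
  filter_upwards [hf₂.coeFn_toLp] with x hx
  rw [hx, SchwartzMap.fourier_coe]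
  rfl

theorem fourierTransform_toLp_ae_eq {f : E → ℂ} (hf₁ : Integrable f) (hf₂ : MemLp f 2 volume) :
    (Lp.fourierTransformₗᵢ E ℂ (hf₂.toLp f) : L2 E) =ᵐ[volume] 𝓕 f := by
  have h_cont : Continuous (𝓕 f : E → ℂ) :=
    VectorFourier.fourierIntegral_continuous Real.continuous_fourierChar
      (by exact continuous_inner) hf₁
  refine ae_eq_of_integral_contDiff_smul_eq
    ((Lp.memLp _).locallyIntegrable (by norm_num)) h_cont.locallyIntegrable fun g hg hg_supp => ?_
  have h_supp : HasCompactSupport (Complex.ofRealCLM ∘ g) := hg_supp.comp_left rfl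
  have h_test : ∫ x, (g x : ℂ) • (Lp.fourierTransformₗᵢ E ℂ (hf₂.toLp f) : L2 E) x
      = ∫ x, (g x : ℂ) • 𝓕 f x :=
    integral_smul_fourierTransform_toLp hf₁ hf₂
      (h_supp.toSchwartzMap (Complex.ofRealCLM.contDiff.comp hg))
  simpa only [Complex.real_smul, smul_eq_mul] using h_test

section Contragredient

variable {B C : E ≃L[ℝ] E} (hB : MeasurePreserving B volume volume)
  (hBC : ∀ x ξ, inner ℝ (B x) (C ξ) = inner ℝ x ξ)

include hB hBC

theorem fourier_comp_of_inner_eq (f : E → ℂ) (ξ : E) : 𝓕 (f ∘ B) ξ = 𝓕 f (C ξ) := by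
  rw [Real.fourier_eq, Real.fourier_eq, ← hB.integral_comp B.toHomeomorph.measurableEmbedding
    fun v => 𝐞 (-inner ℝ v (C ξ)) • f v]
  simp only [hBC, Function.comp]

theorem fourierTransform_compUnitary (hC : MeasurePreserving C volume volume) (φ : L2 E) :
    Lp.fourierTransformₗᵢ E ℂ (compUnitary B hB φ)
      = compUnitary C hC (Lp.fourierTransformₗᵢ E ℂ φ) := by
  refine congrFun ((SchwartzMap.denseRange_toLpCLM (E := E) (F := ℂ) (p := 2) (μ := volume)
    ENNReal.ofNat_ne_top).equalizer
    ((Lp.fourierTransformₗᵢ E ℂ).continuous.comp (compUnitary B hB).continuous)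
    ((compUnitary C hC).continuous.comp (Lp.fourierTransformₗᵢ E ℂ).continuous)
    (funext fun f => ?_)) φ
  change 𝓕 (compUnitary B hB (f.toLp 2 volume)) = compUnitary C hC (𝓕 (f.toLp 2 volume))
  rw [compUnitary_toLp, SchwartzMap.toLp_fourier_eq, SchwartzMap.toLp_fourier_eq,
    compUnitary_toLp]
  congr 1
  ext ξ
  rw [SchwartzMap.fourier_coe]
  exact (fourier_comp_of_inner_eq hB hBC f ξ).trans (by rw [← SchwartzMap.fourier_coe]; rfl)

end Contragredient

theorem fourierTransform_flowUnitary {A : E →L[ℝ] E} (hA : IsNilpotent A) (t : ℝ) (φ : L2 E) :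
    Lp.fourierTransformₗᵢ E ℂ (flowUnitary hA t φ)
      = flowUnitary (isNilpotent_neg_adjoint hA) t (Lp.fourierTransformₗᵢ E ℂ φ) :=
  fourierTransform_compUnitary _ (inner_expFlow_expFlow_neg_adjoint A t) _ φ

end Fourier

/-! ### Tensor products -/

theorem ae_comp_snd {p : Conf 2 → Prop} (h : ∀ᵐ y, p y) : ∀ᵐ x : Conf 3, p !₂[x 1, x 2] :=
  (Measure.quasiMeasurePreserving_snd.comp
    measurePreserving_split.quasiMeasurePreserving).ae h

theorem coeFn_tensor (ψ : L2 ℝ) (φ : L2 (Conf 2)) :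
    tensor ψ φ =ᵐ[volume] fun x : Conf 3 => ψ (x 0) * φ !₂[x 1, x 2] :=
  (memLp_tensor ψ φ).coeFn_toLp

theorem norm_tensor (ψ : L2 ℝ) (φ : L2 (Conf 2)) : ‖tensor ψ φ‖ = ‖ψ‖ * ‖φ‖ := by
  rw [tensor, Lp.norm_toLp, eLpNorm_tensor, ENNReal.toReal_mul, Lp.norm_def, Lp.norm_def]

theorem tensor_sub_right (ψ : L2 ℝ) (φ χ : L2 (Conf 2)) :
    tensor ψ (φ - χ) = tensor ψ φ - tensor ψ χ := by
  unfold tensor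
  rw [← MemLp.toLp_sub]
  refine MemLp.toLp_congr _ _ ?_
  filter_upwards [ae_comp_snd (Lp.coeFn_sub φ χ)] with x hx
  rw [hx]
  exact mul_sub _ _ _

theorem continuous_tensor_right (ψ : L2 ℝ) : Continuous fun φ : L2 (Conf 2) => tensor ψ φ := by
  refine (LipschitzWith.of_dist_le_mul (K := ‖ψ‖₊) fun φ χ => ?_).continuous
  rw [dist_eq_norm, dist_eq_norm, ← tensor_sub_right, norm_tensor, coe_nnnorm]

theorem continuous_tensor_left (φ : L2 (Conf 2)) : Continuous fun ψ : L2 ℝ => tensor ψ φ :=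
  (tensorL φ).continuous

theorem inner_eq_inner_split (x ξ : Conf 3) :
    inner ℝ x ξ = inner ℝ (split x).1 (split ξ).1 + inner ℝ (split x).2 (split ξ).2 := by
  simp [split, PiLp.inner_apply, Fin.sum_univ_three, Fin.sum_univ_two, add_assoc]

theorem fourier_mul_comp_split {f : ℝ → ℂ} {g : Conf 2 → ℂ} (hf : Integrable f)
    (hg : Integrable g) (ξ : Conf 3) :
    𝓕 (fun x : Conf 3 => f (split x).1 * g (split x).2) ξ
      = 𝓕 f (split ξ).1 * 𝓕 g (split ξ).2 := by
  have hf' := (Real.fourierIntegral_convergent_iff (μ := volume) (split ξ).1).2 hf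
  have hg' := (Real.fourierIntegral_convergent_iff (μ := volume) (split ξ).2).2 hg
  have h_meas := (hf'.mul_prod hg').aestronglyMeasurable
  have h_split := measurePreserving_split.map_eq
  rw [Measure.volume_eq_prod] at h_split
  rw [← h_split] at h_meas
  rw [Real.fourier_eq, Real.fourier_eq, Real.fourier_eq, ← integral_prod_mul, ← h_split,
    integral_map measurePreserving_split.aemeasurable h_meas]
  refine integral_congr_ae (.of_forall fun x => ?_)
  simp only [inner_eq_inner_split, neg_add, AddChar.map_add_eq_mul, Circle.smul_def,
    Circle.coe_mul, smul_eq_mul]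
  ring

theorem fourier_tensor_toLp (f : 𝓢(ℝ, ℂ)) (g : 𝓢(Conf 2, ℂ)) :
    fourierL2 3 (tensor (f.toLp 2 volume) (g.toLp 2 volume))
      = tensor ((𝓕 f).toLp 2 volume) ((𝓕 g).toLp 2 volume) := by
  have h_ae (f : 𝓢(ℝ, ℂ)) (g : 𝓢(Conf 2, ℂ)) :
      (fun x : Conf 3 => f.toLp 2 volume (x 0) * g.toLp 2 volume !₂[x 1, x 2])
        =ᵐ[volume] fun x => f (x 0) * g !₂[x 1, x 2] := by
    filter_upwards [ae_comp_fst (f.coeFn_toLp 2 volume), ae_comp_snd (g.coeFn_toLp 2 volume)]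
      with x hf hg
    rw [hf, hg]
  have h_mem := (memLp_congr_ae (h_ae f g)).1 (memLp_tensor _ _)
  have h_int : Integrable fun x : Conf 3 => f (x 0) * g !₂[x 1, x 2] :=
    measurePreserving_split.integrable_comp_of_integrable (f.integrable.mul_prod g.integrable)
  have h_tensor : tensor (f.toLp 2 volume) (g.toLp 2 volume) = h_mem.toLp _ :=
    MemLp.toLp_congr _ _ (h_ae f g)
  rw [h_tensor]
  refine Lp.ext ((fourierTransform_toLp_ae_eq h_int h_mem).trans ?_)
  refine .trans ?_ ((coeFn_tensor _ _).trans (h_ae (𝓕 f) (𝓕 g))).symm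
  exact .of_forall fun ξ => by
    rw [SchwartzMap.fourier_coe, SchwartzMap.fourier_coe]
    exact fourier_mul_comp_split f.integrable g.integrable ξ

theorem fourier_tensor (ψ : L2 ℝ) (φ : L2 (Conf 2)) :
    fourierL2 3 (tensor ψ φ) = tensor (Lp.fourierTransformₗᵢ ℝ ℂ ψ) (fourierL2 2 φ) := by
  have h_schwartz (f : 𝓢(ℝ, ℂ)) (φ : L2 (Conf 2)) : fourierL2 3 (tensor (f.toLp 2 volume) φ)
      = tensor (Lp.fourierTransformₗᵢ ℝ ℂ (f.toLp 2 volume)) (fourierL2 2 φ) := by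
    refine congrFun ((SchwartzMap.denseRange_toLpCLM (F := ℂ) (p := 2) (μ := volume)
      ENNReal.ofNat_ne_top).equalizer
      ((fourierL2 3).continuous.comp (continuous_tensor_right _))
      ((continuous_tensor_right _).comp (fourierL2 2).continuous) (funext fun g => ?_)) φ
    change fourierL2 3 (tensor (f.toLp 2 volume) (g.toLp 2 volume))
      = tensor (𝓕 (f.toLp 2 volume)) (𝓕 (g.toLp 2 volume))
    rw [SchwartzMap.toLp_fourier_eq, SchwartzMap.toLp_fourier_eq, fourier_tensor_toLp]
  exact congrFun ((SchwartzMap.denseRange_toLpCLM (F := ℂ) (p := 2) (μ := volume)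
    ENNReal.ofNat_ne_top).equalizer ((fourierL2 3).continuous.comp (continuous_tensor_left φ))
    ((continuous_tensor_left _).comp (Lp.fourierTransformₗᵢ ℝ ℂ).continuous)
    (funext fun f => h_schwartz f φ)) ψ

/-! ### Position and momentum laws -/

theorem map_withDensity_comp {α β : Type*} [MeasurableSpace α] [MeasurableSpace β]
    {μ : Measure α} {f : α → β} (hf : Measurable f) {g : β → ℝ≥0∞} (hg : Measurable g) :
    (μ.withDensity fun x => g (f x)).map f = (μ.map f).withDensity g := by
  ext s hs
  rw [Measure.map_apply hf hs, withDensity_apply _ (hf hs), withDensity_apply _ hs,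
    setLIntegral_map hs hg hf]

section Law

variable {E : Type*} [NormedAddCommGroup E] [InnerProductSpace ℝ E] [FiniteDimensional ℝ E]
  [MeasurableSpace E] [BorelSpace E]

theorem measurable_coeFn (φ : L2 E) : Measurable (φ : E → ℂ) :=
  (Lp.stronglyMeasurable φ).measurable

theorem measurable_momWave (φ : L2 E) : Measurable (momWave φ) :=
  ((measurable_coeFn _).comp (measurable_const_smul _)).const_mul _

theorem posLaw_apply_univ (φ : L2 E) : posLaw φ Set.univ = ENNReal.ofReal (‖φ‖ ^ 2) := by
  rw [posLaw, withDensity_apply _ MeasurableSet.univ, Measure.restrict_univ,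
    ENNReal.ofReal_pow (norm_nonneg _), ofReal_norm, Lp.enorm_def,
    eLpNorm_eq_lintegral_rpow_enorm_toReal two_ne_zero ENNReal.ofNat_ne_top,
    ← ENNReal.rpow_natCast, ← ENNReal.rpow_mul]
  simp

instance isFiniteMeasure_posLaw (φ : L2 E) : IsFiniteMeasure (posLaw φ) :=
  ⟨by rw [posLaw_apply_univ]; exact ENNReal.ofReal_lt_top⟩

theorem isProbabilityMeasure_posLaw {φ : L2 E} (h : ‖φ‖ = 1) :
    IsProbabilityMeasure (posLaw φ) :=
  ⟨by rw [posLaw_apply_univ, h, one_pow, ENNReal.ofReal_one]⟩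

theorem posLaw_eq_of_ae_eq {φ : L2 E} {f : E → ℂ} (h : φ =ᵐ[volume] f) :
    posLaw φ = volume.withDensity fun x => ‖f x‖ₑ ^ 2 :=
  withDensity_congr_ae (h.fun_comp fun z => ‖z‖ₑ ^ 2)

theorem integral_posLaw (φ : L2 E) (g : E → ℝ) :
    ∫ x, g x ∂posLaw φ = ∫ x, ‖φ x‖ ^ 2 * g x := by
  have h := integral_withDensity_eq_integral_smul (μ := (volume : Measure E))
    (f := fun x => ‖φ x‖₊ ^ 2) ((measurable_coeFn φ).nnnorm.pow_const 2) g
  simp only [ENNReal.coe_pow, ← enorm_eq_nnnorm] at h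
  rw [posLaw, h]
  rfl

theorem map_posLaw_compUnitary {B : E ≃L[ℝ] E} (hB : MeasurePreserving B volume volume)
    (φ : L2 E) : (posLaw (compUnitary B hB φ)).map B = posLaw φ := by
  rw [posLaw_eq_of_ae_eq (coeFn_compUnitary hB φ)]
  refine (map_withDensity_comp hB.measurable ((measurable_coeFn φ).enorm.pow_const 2)).trans ?_
  rw [hB.map_eq, posLaw]

theorem enorm_momWave_sq (φ : L2 E) (p : E) : ‖momWave φ p‖ₑ ^ 2 =
    ENNReal.ofReal |((2 * Real.pi) ^ Module.finrank ℝ E)⁻¹| *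
      ‖(Lp.fourierTransformₗᵢ E ℂ φ : L2 E) ((2 * Real.pi)⁻¹ • p)‖ₑ ^ 2 := by
  have hpi : (0 : ℝ) < 2 * Real.pi := by positivity
  rw [momWave, enorm_mul, mul_pow, ← ofReal_norm, Complex.norm_real,
    ← ENNReal.ofReal_pow (norm_nonneg _), ← norm_pow, ← Real.rpow_natCast, ← Real.rpow_mul hpi.le,
    Real.norm_eq_abs, ← Real.rpow_natCast (2 * Real.pi), ← Real.rpow_neg hpi.le, Nat.cast_ofNat,
    div_mul_cancel₀ _ two_ne_zero]

theorem momLaw_eq_map (φ : L2 E) :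
    momLaw φ = (posLaw (Lp.fourierTransformₗᵢ E ℂ φ)).map fun ξ => (2 * Real.pi) • ξ := by
  have hpi : (2 * Real.pi) ≠ 0 := by positivity
  set F : L2 E := Lp.fourierTransformₗᵢ E ℂ φ
  have h_meas : Measurable fun p : E => ‖F ((2 * Real.pi)⁻¹ • p)‖ₑ ^ 2 :=
    ((measurable_coeFn F).comp (measurable_const_smul _)).enorm.pow_const 2
  have h_map := map_withDensity_comp (μ := (volume : Measure E))
    (f := fun ξ => (2 * Real.pi) • ξ) (measurable_const_smul _) h_meas
  simp only [inv_smul_smul₀ hpi] at h_map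
  rw [posLaw, h_map, Measure.map_addHaar_smul _ hpi, momLaw, withDensity_smul_measure,
    ← withDensity_smul _ h_meas]
  exact congrArg _ (funext (enorm_momWave_sq φ))

instance isFiniteMeasure_momLaw (φ : L2 E) : IsFiniteMeasure (momLaw φ) := by
  rw [momLaw_eq_map]
  infer_instance

theorem isProbabilityMeasure_momLaw {φ : L2 E} (h : ‖φ‖ = 1) :
    IsProbabilityMeasure (momLaw φ) := by
  have := isProbabilityMeasure_posLaw (((Lp.fourierTransformₗᵢ E ℂ).norm_map φ).trans h)
  rw [momLaw_eq_map]
  exact Measure.isProbabilityMeasure_map (measurable_const_smul _).aemeasurable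

/-! ### Multiplication operators -/

/-- Multiplication by an essentially bounded function on `L²`. -/
def mulOp (g : E → ℂ) (hg : MemLp g ∞ volume) : L2 E →L[ℂ] L2 E :=
  (ContinuousLinearMap.mul ℂ ℂ).holderL volume ∞ 2 2 (hg.toLp g)

theorem coeFn_mulOp {g : E → ℂ} (hg : MemLp g ∞ volume) (φ : L2 E) :
    mulOp g hg φ =ᵐ[volume] fun x => g x * φ x := by
  filter_upwards [(ContinuousLinearMap.mul ℂ ℂ).coeFn_holder (r := 2) (hg.toLp g) φ,
    hg.coeFn_toLp] with x h_mul h_coe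
  rw [← h_coe]
  exact h_mul

theorem inner_self_eq_integral_of_ae_eq {φ χ : L2 E} {g : E → ℝ}
    (h : χ =ᵐ[volume] fun x => (g x : ℂ) * φ x) :
    inner ℂ φ χ = ((∫ x, g x ∂posLaw φ : ℝ) : ℂ) := by
  rw [L2.inner_def, integral_posLaw, ← integral_complex_ofReal]
  refine integral_congr_ae ?_
  filter_upwards [h] with x hx
  rw [hx, RCLike.inner_apply, mul_assoc, Complex.mul_conj, Complex.normSq_eq_norm_sq]
  push_cast
  ring

theorem ae_eq_mul_of_inner_eq {T : L2 E →L[ℂ] L2 E} {g : E → ℝ} {C : ℝ} (hg : Measurable g)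
    (hgC : ∀ x, |g x| ≤ C) (hT : ∀ φ, inner ℂ φ (T φ) = ((∫ x, g x ∂posLaw φ : ℝ) : ℂ))
    (φ : L2 E) : T φ =ᵐ[volume] fun x => (g x : ℂ) * φ x := by
  have hg_mem : MemLp (fun x => (g x : ℂ)) ∞ volume :=
    memLp_top_of_bound (Complex.measurable_ofReal.comp hg).aestronglyMeasurable C
      (.of_forall fun x => by simpa using hgC x)
  have h_eq : (T : L2 E →ₗ[ℂ] L2 E) = mulOp _ hg_mem := by
    refine (ext_inner_map _ _).1 fun χ => ?_
    rw [ContinuousLinearMap.coe_coe, ContinuousLinearMap.coe_coe, ← inner_conj_symm,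
      ← inner_conj_symm (mulOp _ _ χ), hT,
      inner_self_eq_integral_of_ae_eq (coeFn_mulOp hg_mem χ)]
  exact congrArg (fun χ : L2 E => ⇑χ) (DFunLike.congr_fun h_eq φ) ▸ coeFn_mulOp hg_mem φ

theorem coeFn_indicatorOp {S : Set E} (hS : MeasurableSet S) (φ : L2 E) :
    indicatorOp S φ =ᵐ[volume] fun x => ((S.indicator (fun _ => (1 : ℝ)) x : ℝ) : ℂ) * φ x := by
  rw [indicatorOp, dif_pos hS]
  refine (coeFn_mulOp _ φ).trans (.of_forall fun x => ?_)
  by_cases hx : x ∈ S <;> simp [hx]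

theorem inner_indicatorOp {S : Set E} (hS : MeasurableSet S) (φ : L2 E) :
    inner ℂ φ (indicatorOp S φ) = (((posLaw φ).real S : ℝ) : ℂ) := by
  rw [inner_self_eq_integral_of_ae_eq (coeFn_indicatorOp hS φ), integral_indicator_const _ hS,
    smul_eq_mul, mul_one]

theorem indicatorOp_univ (φ : L2 E) : indicatorOp Set.univ φ = φ := by
  refine Lp.ext ?_
  filter_upwards [coeFn_indicatorOp MeasurableSet.univ φ] with x hx
  rw [hx, Set.indicator_univ, Complex.ofReal_one, one_mul]

theorem momWave_ae_eq_of_fourierTransform_ae_eq {φ χ : L2 E} {g : E → ℝ}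
    (h : (Lp.fourierTransformₗᵢ E ℂ χ : L2 E) =ᵐ[volume] fun ξ =>
      (g ((2 * Real.pi) • ξ) : ℂ) * (Lp.fourierTransformₗᵢ E ℂ φ : L2 E) ξ) :
    momWave χ =ᵐ[volume] fun p => (g p : ℂ) * momWave φ p := by
  have hpi : (2 * Real.pi) ≠ 0 := by positivity
  have h_scale : Measure.QuasiMeasurePreserving (fun p : E => (2 * Real.pi)⁻¹ • p) := by
    refine ⟨measurable_const_smul _, ?_⟩
    rw [Measure.map_addHaar_smul _ (inv_ne_zero hpi)]
    exact Measure.smul_absolutelyContinuous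
  filter_upwards [h_scale.ae h] with p hp
  rw [momWave, momWave, hp, smul_inv_smul₀ hpi, mul_left_comm]

end Law

section FunctionalCalculus

variable {T : L2 ℝ →L[ℂ] L2 ℝ} {g : ℝ → ℝ} {C : ℝ}

theorem isFunOfPos_of_inner (hg : Measurable g) (hgC : ∀ x, |g x| ≤ C)
    (hT : ∀ ψ, inner ℂ ψ (T ψ) = ((∫ x, g x ∂posLaw ψ : ℝ) : ℂ)) : IsFunOfPos T g :=
  ae_eq_mul_of_inner_eq hg hgC hT

theorem isFunOfMom_of_inner (hg : Measurable g) (hgC : ∀ x, |g x| ≤ C)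
    (hT : ∀ ψ, inner ℂ ψ (T ψ) = ((∫ x, g x ∂momLaw ψ : ℝ) : ℂ)) : IsFunOfMom T g := by
  let F := Lp.fourierTransformₗᵢ ℝ ℂ
  let T' : L2 ℝ →L[ℂ] L2 ℝ := F.toContinuousLinearEquiv.toContinuousLinearMap ∘L T ∘L
    F.symm.toContinuousLinearEquiv.toContinuousLinearMap
  have hT' (φ : L2 ℝ) :
      inner ℂ φ (T' φ) = ((∫ ξ, g ((2 * Real.pi) • ξ) ∂posLaw φ : ℝ) : ℂ) := by
    have h := hT (F.symm φ)
    rw [momLaw_eq_map, integral_map (measurable_const_smul _).aemeasurable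
      hg.aestronglyMeasurable] at h
    calc inner ℂ φ (F (T (F.symm φ)))
        = inner ℂ (F (F.symm φ)) (F (T (F.symm φ))) := by rw [F.apply_symm_apply]
      _ = _ := by rw [F.inner_map_map, h]; exact congrArg _ (by rw [F.apply_symm_apply])
  intro ψ
  refine momWave_ae_eq_of_fourierTransform_ae_eq ?_
  have h_eq : T' (F ψ) = F (T ψ) := by
    change F (T (F.symm (F ψ))) = F (T ψ)
    rw [F.symm_apply_apply]
  rw [← h_eq]
  exact ae_eq_mul_of_inner_eq (hg.comp (measurable_const_smul _)) (fun _ => hgC _) hT' (F ψ)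

end FunctionalCalculus

/-! ### Outcome statistics after the coupling -/

theorem map_split_posLaw_tensor (ψ : L2 ℝ) (φ : L2 (Conf 2)) :
    (posLaw (tensor ψ φ)).map split = (posLaw ψ).prod (posLaw φ) := by
  have hψ : Measurable fun y : ℝ => ‖ψ y‖ₑ ^ 2 := (measurable_coeFn ψ).enorm.pow_const 2
  have hφ : Measurable fun y : Conf 2 => ‖φ y‖ₑ ^ 2 := (measurable_coeFn φ).enorm.pow_const 2
  have h_map := map_withDensity_comp (μ := (volume : Measure (Conf 3)))
    measurePreserving_split.measurable
    ((hψ.comp measurable_fst).mul (hφ.comp measurable_snd))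
  rw [measurePreserving_split.map_eq, Measure.volume_eq_prod] at h_map
  rw [posLaw_eq_of_ae_eq (coeFn_tensor ψ φ), posLaw, posLaw, prod_withDensity hψ hφ]
  refine Eq.trans ?_ h_map
  simp only [enorm_mul, mul_pow]
  rfl

/-- The law of the difference `a - t` of independent variables `a ∼ ρ` and `t ∼ N`. -/
def diffLaw (ρ N : Measure ℝ) : Measure ℝ := (ρ.prod N).map fun z => z.1 - z.2

instance isProbabilityMeasure_diffLaw (ρ N : Measure ℝ) [IsProbabilityMeasure ρ]
    [IsProbabilityMeasure N] : IsProbabilityMeasure (diffLaw ρ N) :=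
  Measure.isProbabilityMeasure_map (by fun_prop)

instance isFiniteMeasure_diffLaw (ρ N : Measure ℝ) [IsFiniteMeasure ρ] [IsFiniteMeasure N] :
    IsFiniteMeasure (diffLaw ρ N) :=
  inferInstanceAs (IsFiniteMeasure (Measure.map _ _))

theorem diffLaw_map {Ω Ω' : Type*} [MeasurableSpace Ω] [MeasurableSpace Ω'] (ρ : Measure Ω)
    (ν : Measure Ω') [SFinite ρ] [SFinite ν] {m : Ω → ℝ} {n : Ω' → ℝ} (hm : Measurable m)
    (hn : Measurable n) :
    diffLaw (ρ.map m) (ν.map n) = (ρ.prod ν).map fun z => m z.1 - n z.2 := by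
  rw [diffLaw, Measure.map_prod_map _ _ hm hn, Measure.map_map (by fun_prop) (hm.prodMap hn)]
  rfl

/-- The position noise as a function of the probe positions. -/
def noiseQ (lam mu kap : ℝ) (y : Conf 2) : ℝ := mu / 2 * (1 - kap) * y 1 - 1 / lam * y 0

/-- The momentum noise as a function of the probe momenta. -/
def noiseP (lam mu kap : ℝ) (y : Conf 2) : ℝ := lam / 2 * (1 + kap) * y 0 - 1 / mu * y 1

@[fun_prop]
theorem measurable_noiseQ (lam mu kap : ℝ) : Measurable (noiseQ lam mu kap) := by
  unfold noiseQ
  fun_prop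

@[fun_prop]
theorem measurable_noiseP (lam mu kap : ℝ) : Measurable (noiseP lam mu kap) := by
  unfold noiseP
  fun_prop

theorem map_posLaw_flowUnitary {E : Type*} [NormedAddCommGroup E] [InnerProductSpace ℝ E]
    [FiniteDimensional ℝ E] [MeasurableSpace E] [BorelSpace E] {A : E →L[ℝ] E}
    (hA : IsNilpotent A) (t : ℝ) (φ : L2 E) :
    (posLaw (flowUnitary hA t φ)).map (expFlow A t) = posLaw φ :=
  map_posLaw_compUnitary _ φ

/-- In the Heisenberg picture the pointer `Q₁ / λ` becomes the sum of `Q` and a noise operator in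
`Q₁, Q₂`, up to the sign convention of `diffLaw`. -/
theorem map_posLaw_coupling_tensor {lam : ℝ} (hlam : lam ≠ 0) (mu kap : ℝ) (ψ : L2 ℝ)
    (φ : L2 (Conf 2)) :
    (posLaw (coupling lam mu kap (tensor ψ φ))).map (fun x => lam⁻¹ * x 1) =
      diffLaw (posLaw ψ) ((posLaw φ).map (noiseQ lam mu kap)) := by
  have h_split := measurePreserving_split.measurable
  conv_rhs => rw [← Measure.map_id (μ := posLaw ψ)]
  rw [diffLaw_map _ _ measurable_id (by fun_prop), ← map_split_posLaw_tensor,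
    Measure.map_map (by fun_prop) h_split, coupling_eq_flowUnitary,
    ← map_posLaw_flowUnitary (isNilpotent_couplingGen lam mu kap) 1 (tensor ψ φ),
    Measure.map_map ((by fun_prop : Measurable _).comp h_split) (by fun_prop)]
  congr 1
  funext x
  simp only [Function.comp_apply, split, expFlow_couplingGen_one, noiseQ, id, Matrix.cons_val,
    Matrix.cons_val_zero, Matrix.cons_val_one]
  field_simp
  ring

theorem map_momLaw_coupling_tensor (lam : ℝ) {mu : ℝ} (hmu : mu ≠ 0) (kap : ℝ) (ψ : L2 ℝ)
    (φ : L2 (Conf 2)) :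
    (momLaw (coupling lam mu kap (tensor ψ φ))).map (fun p => mu⁻¹ * p 2) =
      diffLaw (momLaw ψ) ((momLaw φ).map (noiseP lam mu kap)) := by
  have h_split := measurePreserving_split.measurable
  have h_fourier : Lp.fourierTransformₗᵢ (Conf 3) ℂ (tensor ψ φ) =
      tensor (Lp.fourierTransformₗᵢ ℝ ℂ ψ) (Lp.fourierTransformₗᵢ (Conf 2) ℂ φ) :=
    fourier_tensor ψ φ
  rw [momLaw_eq_map, momLaw_eq_map, momLaw_eq_map,
    Measure.map_map (by fun_prop) (measurable_const_smul _),
    Measure.map_map (by fun_prop) (measurable_const_smul _),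
    diffLaw_map _ _ (measurable_const_smul _)
      ((measurable_noiseP lam mu kap).comp (measurable_const_smul _)),
    ← map_split_posLaw_tensor, Measure.map_map (by fun_prop) h_split, coupling_eq_flowUnitary,
    fourierTransform_flowUnitary, ← h_fourier,
    ← map_posLaw_flowUnitary (isNilpotent_neg_adjoint (isNilpotent_couplingGen lam mu kap)) 1
      (Lp.fourierTransformₗᵢ (Conf 3) ℂ (tensor ψ φ)),
    Measure.map_map ((by fun_prop : Measurable _).comp h_split) (by fun_prop)]
  congr 1
  funext ξ
  simp only [Function.comp_apply, split, expFlow_neg_adjoint_couplingGen_one, noiseP,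
    PiLp.smul_apply, smul_eq_mul, Matrix.cons_val, Matrix.cons_val_zero, Matrix.cons_val_one]
  field_simp
  ring

theorem inner_posProj {n : ℕ} (j : Fin n) {X : Set ℝ} (hX : MeasurableSet X) (Ψ : L2 (Conf n)) :
    inner ℂ Ψ (posProj j X Ψ) = (((posLaw Ψ).real {x | x j ∈ X} : ℝ) : ℂ) :=
  inner_indicatorOp ((by fun_prop : Measurable fun x : Conf n => x j) hX) Ψ

theorem inner_momProj {n : ℕ} (j : Fin n) {Y : Set ℝ} (hY : MeasurableSet Y) (Ψ : L2 (Conf n)) :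
    inner ℂ Ψ (momProj j Y Ψ) = (((momLaw Ψ).real {p | p j ∈ Y} : ℝ) : ℂ) := by
  have h_coord : Measurable fun p : Conf n => p j := by fun_prop
  have h_set : MeasurableSet {p : Conf n | p j ∈ Y} := h_coord hY
  have h_scaled : MeasurableSet {ξ : Conf n | 2 * Real.pi * ξ j ∈ Y} := h_coord.const_mul _ hY
  rw [momLaw_eq_map, map_measureReal_apply (measurable_const_smul _) h_set]
  refine Eq.trans ?_ (inner_indicatorOp h_scaled (fourierL2 n Ψ))
  rw [← (fourierL2 n).inner_map_map]
  exact congrArg _ ((fourierL2 n).apply_symm_apply _)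

theorem posProj_univ {n : ℕ} (j : Fin n) :
    posProj j Set.univ = ContinuousLinearMap.id ℂ (L2 (Conf n)) :=
  ContinuousLinearMap.ext indicatorOp_univ

theorem momProj_univ {n : ℕ} (j : Fin n) :
    momProj j Set.univ = ContinuousLinearMap.id ℂ (L2 (Conf n)) := by
  ext1 Ψ
  change (fourierL2 n).symm (indicatorOp Set.univ (fourierL2 n Ψ)) = Ψ
  rw [indicatorOp_univ, (fourierL2 n).symm_apply_apply]

/-! ### Mixtures of probe states -/

namespace ProbeState

variable {ι : Type*} (σ : ProbeState ι)

theorem tsum_ofReal_weight : ∑' i, ENNReal.ofReal (σ.weight i) = 1 := by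
  rw [← ENNReal.ofReal_tsum_of_nonneg σ.weight_nonneg σ.weight_sum.summable,
    σ.weight_sum.tsum_eq, ENNReal.ofReal_one]

section Mix

variable {Ω : Type*} [MeasurableSpace Ω] {ν : ι → Measure Ω}

/-- The mixture of the measures `ν i` with the weights of `σ`. The laws `σ.posLaw` and `σ.momLaw`
are by definition mixtures of this kind. -/
def mix (ν : ι → Measure Ω) : Measure Ω :=
  Measure.sum fun i => ENNReal.ofReal (σ.weight i) • ν i

theorem isProbabilityMeasure_mix (hν : ∀ i, IsProbabilityMeasure (ν i)) :
    IsProbabilityMeasure (σ.mix ν) :=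
  ⟨by simp [mix, Measure.sum_apply _ MeasurableSet.univ, σ.tsum_ofReal_weight]⟩

theorem map_mix {Ω' : Type*} [MeasurableSpace Ω'] {n : Ω → Ω'} (hn : Measurable n) :
    (σ.mix ν).map n = σ.mix fun i => (ν i).map n := by
  simp only [mix, Measure.map_sum hn.aemeasurable, Measure.map_smul]

theorem hasSum_mix_real (hν : ∀ i, IsFiniteMeasure (ν i)) [IsFiniteMeasure (σ.mix ν)] {S : Set Ω}
    (hS : MeasurableSet S) :
    HasSum (fun i => σ.weight i * (ν i).real S) ((σ.mix ν).real S) := by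
  have h_apply : σ.mix ν S = ∑' i, ENNReal.ofReal (σ.weight i) * ν i S := by
    simp only [mix, Measure.sum_apply _ hS, Measure.smul_apply, smul_eq_mul]
  have h_sum := ENNReal.hasSum_toReal (h_apply ▸ measure_ne_top (σ.mix ν) S)
  rw [← ENNReal.tsum_toReal_eq fun i => ENNReal.mul_ne_top ENNReal.ofReal_ne_top
    (measure_ne_top _ _), ← h_apply] at h_sum
  simpa only [ENNReal.toReal_mul, ENNReal.toReal_ofReal (σ.weight_nonneg _)] using! h_sum

theorem diffLaw_mix [Countable ι] (ρ : Measure ℝ) {ν : ι → Measure ℝ}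
    [∀ i, SFinite (ν i)] : diffLaw ρ (σ.mix ν) = σ.mix fun i => diffLaw ρ (ν i) := by
  simp only [diffLaw]
  rw [← σ.map_mix (by fun_prop), mix, Measure.prod_sum_right]
  simp only [Measure.prod_smul_right, mix]

end Mix

instance isProbabilityMeasure_posLaw : IsProbabilityMeasure σ.posLaw :=
  σ.isProbabilityMeasure_mix fun i => ArthursKelly.isProbabilityMeasure_posLaw (σ.norm_vec i)

instance isProbabilityMeasure_momLaw : IsProbabilityMeasure σ.momLaw :=
  σ.isProbabilityMeasure_mix fun i => ArthursKelly.isProbabilityMeasure_momLaw (σ.norm_vec i)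

end ProbeState

/-! ### The effective observables -/

section Effective

variable {ι : Type*} (U : L2 (Conf 3) ≃ₗᵢ[ℂ] L2 (Conf 3)) (σ : ProbeState ι)

theorem norm_comp_tensorL_le (φ : L2 (Conf 2)) :
    ‖U.toContinuousLinearEquiv.toContinuousLinearMap ∘L tensorL φ‖ ≤ ‖φ‖ := by
  refine ContinuousLinearMap.opNorm_le_bound _ (norm_nonneg _) fun χ => ?_
  change ‖U (tensor χ φ)‖ ≤ _
  rw [U.norm_map, norm_tensor, mul_comm]

theorem norm_adjoint_comp_comp_le {H K : Type*} [NormedAddCommGroup H] [InnerProductSpace ℂ H]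
    [CompleteSpace H] [NormedAddCommGroup K] [InnerProductSpace ℂ K] [CompleteSpace K]
    (A : H →L[ℂ] K) (M : K →L[ℂ] K) :
    ‖ContinuousLinearMap.adjoint A ∘L M ∘L A‖ ≤ ‖M‖ * ‖A‖ ^ 2 :=
  calc ‖ContinuousLinearMap.adjoint A ∘L M ∘L A‖
      ≤ ‖ContinuousLinearMap.adjoint A‖ * (‖M‖ * ‖A‖) :=
        (ContinuousLinearMap.opNorm_comp_le _ _).trans (by
          gcongr; exact ContinuousLinearMap.opNorm_comp_le _ _)
    _ = ‖M‖ * ‖A‖ ^ 2 := by rw [LinearIsometryEquiv.norm_map]; ring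

theorem hasSum_inner_effective (M : L2 (Conf 3) →L[ℂ] L2 (Conf 3)) (ψ : L2 ℝ) :
    HasSum (fun i => (σ.weight i : ℂ) *
      inner ℂ (U (tensor ψ (σ.vec i))) (M (U (tensor ψ (σ.vec i)))))
      (inner ℂ ψ (effective U σ M ψ)) := by
  let A (i : ι) : L2 ℝ →L[ℂ] L2 (Conf 3) :=
    U.toContinuousLinearEquiv.toContinuousLinearMap ∘L tensorL (σ.vec i)
  have h_summable : Summable fun i => (σ.weight i : ℂ) •
      (ContinuousLinearMap.adjoint (A i) ∘L M ∘L A i) := by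
    refine .of_norm_bounded (σ.weight_sum.summable.mul_right ‖M‖) fun i => ?_
    have hA : ‖A i‖ ≤ 1 := (norm_comp_tensorL_le U _).trans_eq (σ.norm_vec i)
    rw [norm_smul, Complex.norm_real, Real.norm_of_nonneg (σ.weight_nonneg i)]
    refine mul_le_mul_of_nonneg_left ?_ (σ.weight_nonneg i)
    refine (norm_adjoint_comp_comp_le (A i) M).trans ?_
    exact mul_le_of_le_one_right (norm_nonneg _) (pow_le_one₀ (norm_nonneg _) hA)
  refine (h_summable.hasSum.mapL
    (innerSL ℂ ψ ∘L ContinuousLinearMap.apply ℂ (L2 ℝ) ψ)).congr_fun fun i => ?_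
  simp only [ContinuousLinearMap.comp_apply, ContinuousLinearMap.apply_apply, smul_apply,
    innerSL_apply_apply, inner_smul_right, ContinuousLinearMap.adjoint_inner_right]
  rfl

theorem inner_effective_eq_diffLaw [Countable ι] (M : L2 (Conf 3) →L[ℂ] L2 (Conf 3)) (ψ : L2 ℝ)
    (ρ : Measure ℝ) [IsFiniteMeasure ρ] {ν : ι → Measure ℝ}
    (hν : ∀ i, IsProbabilityMeasure (ν i)) {X : Set ℝ} (hX : MeasurableSet X)
    (h : ∀ i, inner ℂ (U (tensor ψ (σ.vec i))) (M (U (tensor ψ (σ.vec i)))) =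
      (((diffLaw ρ (ν i)).real X : ℝ) : ℂ)) :
    inner ℂ ψ (effective U σ M ψ) = (((diffLaw ρ (σ.mix ν)).real X : ℝ) : ℂ) := by
  have := σ.isProbabilityMeasure_mix hν
  have h_fin : IsFiniteMeasure (σ.mix fun i => diffLaw ρ (ν i)) :=
    σ.diffLaw_mix ρ (ν := ν) ▸ inferInstance
  have h_effective := hasSum_inner_effective U σ M ψ
  simp only [h, ← Complex.ofReal_mul] at h_effective
  rw [σ.diffLaw_mix]
  exact h_effective.unique
    (Complex.hasSum_ofReal.2 (σ.hasSum_mix_real (fun i => inferInstance) hX))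

/-- The observable `A` measures, with independent additive noise, the quantity whose distribution
in the state `ψ` is `law ψ`: the outcomes of `A` are distributed like `a - t` with `a ∼ law ψ` and
`t ∼ N`. -/
def HasNoiseLaw (law : L2 ℝ → Measure ℝ) (A : Set ℝ → (L2 ℝ →L[ℂ] L2 ℝ)) (N : Measure ℝ) : Prop :=
  ∀ X, MeasurableSet X → ∀ ψ,
    inner ℂ ψ (A X ψ) = (((diffLaw (law ψ) N).real X : ℝ) : ℂ)

variable [Countable ι] {lam mu : ℝ} (kap : ℝ)

theorem hasNoiseLaw_posProj (hlam : lam ≠ 0) (mu : ℝ) :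
    HasNoiseLaw posLaw (fun X => effective (coupling lam mu kap) σ (posProj 1 (lam • X)))
      (σ.posLaw.map (noiseQ lam mu kap)) := by
  intro X hX ψ
  have h_prob (i : ι) := isProbabilityMeasure_posLaw (σ.norm_vec i)
  refine Eq.trans (inner_effective_eq_diffLaw _ σ _ ψ (posLaw ψ) (fun i =>
    Measure.isProbabilityMeasure_map (measurable_noiseQ lam mu kap).aemeasurable) hX fun i => ?_)
    (by rw [← σ.map_mix (measurable_noiseQ lam mu kap)]; rfl)
  rw [inner_posProj 1 (hX.const_smul_of_ne_zero hlam), ← map_posLaw_coupling_tensor hlam,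
    map_measureReal_apply (by fun_prop) hX]
  simp only [Set.mem_smul_set_iff_inv_smul_mem₀ hlam, smul_eq_mul]
  rfl

theorem hasNoiseLaw_momProj (lam : ℝ) (hmu : mu ≠ 0) :
    HasNoiseLaw momLaw (fun Y => effective (coupling lam mu kap) σ (momProj 2 (mu • Y)))
      (σ.momLaw.map (noiseP lam mu kap)) := by
  intro Y hY ψ
  have h_prob (i : ι) := isProbabilityMeasure_momLaw (σ.norm_vec i)
  refine Eq.trans (inner_effective_eq_diffLaw _ σ _ ψ (momLaw ψ) (fun i =>
    Measure.isProbabilityMeasure_map (measurable_noiseP lam mu kap).aemeasurable) hY fun i => ?_)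
    (by rw [← σ.map_mix (measurable_noiseP lam mu kap)]; rfl)
  rw [inner_momProj 2 (hY.const_smul_of_ne_zero hmu), ← map_momLaw_coupling_tensor _ hmu,
    map_measureReal_apply (by fun_prop) hY]
  simp only [Set.mem_smul_set_iff_inv_smul_mem₀ hmu, smul_eq_mul]
  rfl

theorem hasNoiseLaw_obsE (hlam : lam ≠ 0) (hmu : mu ≠ 0) :
    HasNoiseLaw posLaw (obsE lam mu kap σ) (σ.posLaw.map (noiseQ lam mu kap)) := by
  convert hasNoiseLaw_posProj σ kap hlam mu using 2
  rw [obsE, obsG, Set.smul_set_univ₀ hmu, momProj_univ, ContinuousLinearMap.comp_id]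

theorem hasNoiseLaw_obsF (hlam : lam ≠ 0) (hmu : mu ≠ 0) :
    HasNoiseLaw momLaw (obsF lam mu kap σ) (σ.momLaw.map (noiseP lam mu kap)) := by
  convert hasNoiseLaw_momProj σ kap lam hmu using 2
  rw [obsF, obsG, Set.smul_set_univ₀ hlam, posProj_univ, ContinuousLinearMap.id_comp]

theorem hasNoiseLaw_obsE0 (hlam : lam ≠ 0) :
    HasNoiseLaw posLaw (obsE0 lam kap σ) (σ.posLaw.map (noiseQ lam 0 kap)) :=
  hasNoiseLaw_posProj σ kap hlam 0

theorem hasNoiseLaw_obsF0 (hmu : mu ≠ 0) :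
    HasNoiseLaw momLaw (obsF0 mu kap σ) (σ.momLaw.map (noiseP 0 mu kap)) :=
  hasNoiseLaw_momProj σ kap 0 hmu

end Effective

/-! ### Densities of the noise laws -/

/-- `e` is a density of the measure `N` with respect to Lebesgue measure. -/
def IsDensityOf (e : ℝ → ℝ) (N : Measure ℝ) : Prop :=
  (∀ q, 0 ≤ e q) ∧ AEMeasurable e ∧ N = volume.withDensity fun q => ENNReal.ofReal (e q)

theorem isDensityOf_of_eq_toReal {N : Measure ℝ} [IsFiniteMeasure N] {e : ℝ → ℝ} {g : ℝ → ℝ≥0∞}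
    (hg : Measurable g) (hN : N = volume.withDensity g) (he : ∀ q, 0 ≤ e q)
    (heg : ∀ q, g q ≠ ∞ → e q = (g q).toReal) : IsDensityOf e N := by
  have h_finite : ∀ᵐ q, g q < ∞ := by
    refine ae_lt_top hg ?_
    rw [← setLIntegral_univ, ← withDensity_apply _ MeasurableSet.univ, ← hN]
    exact measure_ne_top N _
  refine ⟨he, ⟨_, hg.ennreal_toReal, ?_⟩, hN.trans (withDensity_congr_ae ?_)⟩
  · filter_upwards [h_finite] with q hq
    exact heg q hq.ne
  · filter_upwards [h_finite] with q hq
    rw [heg q hq.ne, ENNReal.ofReal_toReal hq.ne]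

theorem map_withDensity_smul_map_prod {α β γ : Type*} [MeasurableSpace α] [MeasurableSpace β]
    [MeasurableSpace γ] {ν : Measure β} {ρ : Measure γ} [SFinite ν] [SFinite ρ] {c : β × γ → α}
    {n : α → β} (hc : Measurable c) (hn : Measurable n) (hnc : ∀ z, n (c z) = z.1) (K : ℝ≥0∞)
    {g : α → ℝ≥0∞} (hg : Measurable g) :
    ((K • (ν.prod ρ).map c).withDensity g).map n =
      ν.withDensity fun q => K * ∫⁻ q', g (c (q, q')) ∂ρ := by
  have hgc : Measurable fun z => g (c z) := hg.comp hc
  ext s hs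
  have h_preimage : c ⁻¹' (n ⁻¹' s) = s ×ˢ Set.univ := by
    ext z
    simp [hnc]
  rw [Measure.map_apply hn hs, withDensity_apply _ (hn hs), withDensity_apply _ hs,
    Measure.restrict_smul, lintegral_smul_measure, setLIntegral_map (hn hs) hg hc, h_preimage,
    setLIntegral_prod _ hgc.aemeasurable, lintegral_const_mul _ hgc.lintegral_prod_right']
  simp only [Measure.restrict_univ, smul_eq_mul]

theorem ProbeState.mix_withDensity {ι Ω : Type*} [Countable ι] [MeasurableSpace Ω]
    (σ : ProbeState ι) (μ : Measure Ω) {g : ι → Ω → ℝ≥0∞} (hg : ∀ i, Measurable (g i)) :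
    σ.mix (fun i => μ.withDensity (g i)) =
      μ.withDensity fun x => ∑' i, ENNReal.ofReal (σ.weight i) * g i x := by
  have h_tsum : (fun x => ∑' i, ENNReal.ofReal (σ.weight i) * g i x) =
      ∑' i, ENNReal.ofReal (σ.weight i) • g i := by
    funext x
    simp only [tsum_apply (Pi.summable.2 fun _ => ENNReal.summable), Pi.smul_apply, smul_eq_mul]
  rw [h_tsum, withDensity_tsum fun i => (hg i).const_smul _, mix]
  simp only [withDensity_smul _ (hg _)]

theorem integral_norm_sq_eq_toReal_lintegral {Ω F : Type*} [MeasurableSpace Ω]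
    [NormedAddCommGroup F] {μ : Measure Ω} {f : Ω → F} (hf : AEStronglyMeasurable f μ) :
    ∫ x, ‖f x‖ ^ 2 ∂μ = (∫⁻ x, ‖f x‖ₑ ^ 2 ∂μ).toReal := by
  rw [integral_eq_lintegral_of_nonneg_ae (.of_forall fun _ => by positivity)
    (by fun_prop)]
  simp only [ENNReal.ofReal_pow (norm_nonneg _), ofReal_norm]

theorem isDensityOf_map_mix {ι Ω : Type*} [Countable ι] [MeasurableSpace Ω] (σ : ProbeState ι)
    {w : ι → Ω → ℂ} (hw : ∀ i, Measurable (w i)) {c : ℝ × ℝ → Ω} {n : Ω → ℝ} (hc : Measurable c)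
    (hn : Measurable n) (hnc : ∀ z, n (c z) = z.1) {K : ℝ} (hK : 0 ≤ K) {μ : Measure Ω}
    (hμ : μ = ENNReal.ofReal K • (volume : Measure (ℝ × ℝ)).map c)
    [IsFiniteMeasure (σ.mix fun i => μ.withDensity fun y => ‖w i y‖ₑ ^ 2)] :
    IsDensityOf (fun q => K * ∑' i, σ.weight i * ∫ q', ‖w i (c (q, q'))‖ ^ 2)
      ((σ.mix fun i => μ.withDensity fun y => ‖w i y‖ₑ ^ 2).map n) := by
  have h_sq (i : ι) : Measurable fun y => ‖w i y‖ₑ ^ 2 := (hw i).enorm.pow_const 2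
  have h_marginal (i : ι) :
      Measurable fun q => ENNReal.ofReal K * ∫⁻ q', ‖w i (c (q, q'))‖ₑ ^ 2 :=
    (((h_sq i).comp hc).lintegral_prod_right').const_mul _
  refine isDensityOf_of_eq_toReal (g := fun q => ∑' i, ENNReal.ofReal (σ.weight i) *
    (ENNReal.ofReal K * ∫⁻ q', ‖w i (c (q, q'))‖ₑ ^ 2)) (.tsum fun i => (h_marginal i).const_mul _)
    ?_ (fun q => mul_nonneg hK (tsum_nonneg fun i =>
      mul_nonneg (σ.weight_nonneg i) (integral_nonneg fun _ => by positivity))) fun q hq => ?_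
  · rw [σ.map_mix hn, hμ, Measure.volume_eq_prod, ← σ.mix_withDensity _ h_marginal]
    simp only [map_withDensity_smul_map_prod hc hn hnc _ (h_sq _)]
  · have h_slice (i : ι) : AEStronglyMeasurable fun q' => w i (c (q, q')) :=
      ((hw i).comp (hc.comp measurable_prodMk_left)).aestronglyMeasurable
    rw [ENNReal.tsum_toReal_eq (ENNReal.ne_top_of_tsum_ne_top hq), ← tsum_mul_left]
    refine tsum_congr fun i => ?_
    rw [integral_norm_sq_eq_toReal_lintegral (h_slice i), ENNReal.toReal_mul,
      ENNReal.toReal_mul, ENNReal.toReal_ofReal hK, ENNReal.toReal_ofReal (σ.weight_nonneg i)]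
    exact mul_left_comm _ _ _

theorem volume_eq_smul_map_linear {a b c d K : ℝ} (hK : 0 < K) (h_det : |a * d - b * c| = K) :
    (volume : Measure (Conf 2)) = ENNReal.ofReal K •
      (volume : Measure (ℝ × ℝ)).map fun z => !₂[a * z.1 + b * z.2, c * z.1 + d * z.2] := by
  set M : Matrix (Fin 2) (Fin 2) ℝ := !![a, b; c, d] with hM
  have h_abs_det : |M.det| = K := by rw [hM, Matrix.det_fin_two_of, h_det]
  have h_det_ne : M.det ≠ 0 := abs_pos.1 (h_abs_det ▸ hK)
  have h_arrow := (volume_preserving_finTwoArrow ℝ).symm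
  have h_toLp := PiLp.volume_preserving_toLp (Fin 2)
  have h_lin : Measurable (Matrix.toLin' M) :=
    (Matrix.toLin' M).continuous_of_finiteDimensional.measurable
  have h_comp : (fun z : ℝ × ℝ => (!₂[a * z.1 + b * z.2, c * z.1 + d * z.2] : Conf 2)) =
      WithLp.toLp 2 ∘ Matrix.toLin' M ∘ MeasurableEquiv.finTwoArrow.symm := by
    funext z
    ext i
    fin_cases i <;> simp [hM, mul_comm]
  rw [h_comp, ← Measure.map_map h_toLp.measurable (h_lin.comp h_arrow.measurable),
    ← Measure.map_map h_lin h_arrow.measurable, h_arrow.map_eq,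
    Real.map_matrix_volume_pi_eq_smul_volume_pi h_det_ne, Measure.map_smul, h_toLp.map_eq,
    smul_smul, ← ENNReal.ofReal_mul hK.le, abs_inv, h_abs_det, mul_inv_cancel₀ hK.ne',
    ENNReal.ofReal_one, one_smul]

theorem isDensityOf_map_mix_linear {ι : Type*} [Countable ι] (σ : ProbeState ι)
    {w : ι → Conf 2 → ℂ} (hw : ∀ i, Measurable (w i)) {n : Conf 2 → ℝ} (hn : Measurable n)
    {a b c d K : ℝ} (hK : 0 < K) (h_det : |a * d - b * c| = K)
    (h_inv : ∀ q q', n !₂[a * q + b * q', c * q + d * q'] = q)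
    {P : Measure (Conf 2)} [IsFiniteMeasure P]
    (hP : P = σ.mix fun i => volume.withDensity fun y => ‖w i y‖ₑ ^ 2) {e : ℝ → ℝ}
    (he : ∀ q, e q = K * ∑' i, σ.weight i *
      ∫ q' : ℝ, ‖w i !₂[a * q + b * q', c * q + d * q']‖ ^ 2) :
    IsDensityOf e (P.map n) := by
  obtain rfl := funext he
  subst hP
  exact isDensityOf_map_mix σ hw (by fun_prop) hn (fun z => h_inv z.1 z.2) hK.le
    (volume_eq_smul_map_linear hK h_det)

section NoiseDensities

variable {ι : Type*} [Countable ι] {lam mu : ℝ}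

theorem isDensityOf_noiseE (hlam : 0 < lam) (hmu : 0 < mu) (kap : ℝ) (σ : ProbeState ι) :
    IsDensityOf (noiseE lam mu kap σ) (σ.posLaw.map (noiseQ lam mu kap)) := by
  have h_arg (q q' : ℝ) : (!₂[lam * ((1 - kap) / 2 * q' - q), q' / mu] : Conf 2) =
      !₂[-lam * q + lam * (1 - kap) / 2 * q', 0 * q + 1 / mu * q'] := by
    congr 2 <;> ring_nf
  have h_det : |-lam * (1 / mu) - lam * (1 - kap) / 2 * 0| = lam / mu := by
    rw [abs_eq (by positivity)]
    exact Or.inr (by ring)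
  refine isDensityOf_map_mix_linear (P := σ.posLaw) σ (fun i => measurable_coeFn (σ.vec i))
    (measurable_noiseQ lam mu kap) (div_pos hlam hmu) h_det (fun q q' => ?_) rfl
    (fun q => by simp only [noiseE, h_arg])
  simp only [noiseQ, Matrix.cons_val_zero, Matrix.cons_val_one]
  field_simp
  ring

theorem isDensityOf_noiseF (hlam : 0 < lam) (hmu : 0 < mu) (kap : ℝ) (σ : ProbeState ι) :
    IsDensityOf (noiseF lam mu kap σ) (σ.momLaw.map (noiseP lam mu kap)) := by
  have h_arg (p w : ℝ) : (!₂[w / lam, mu * (w / 2 * (kap + 1) - p)] : Conf 2) =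
      !₂[0 * p + 1 / lam * w, -mu * p + mu * (kap + 1) / 2 * w] := by
    congr 2 <;> ring_nf
  have h_det : |0 * (mu * (kap + 1) / 2) - 1 / lam * -mu| = mu / lam := by
    rw [abs_eq (by positivity)]
    exact Or.inl (by ring)
  refine isDensityOf_map_mix_linear (P := σ.momLaw) σ (fun i => measurable_momWave (σ.vec i))
    (measurable_noiseP lam mu kap) (div_pos hmu hlam) h_det (fun p w => ?_) rfl
    (fun p => by simp only [noiseF, h_arg])
  simp only [noiseP, Matrix.cons_val_zero, Matrix.cons_val_one]
  field_simp
  ring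

theorem isDensityOf_noiseE0 (hlam : 0 < lam) (kap : ℝ) (σ : ProbeState ι) :
    IsDensityOf (noiseE0 lam σ) (σ.posLaw.map (noiseQ lam 0 kap)) := by
  have h_arg (q q₂ : ℝ) : (!₂[-(lam * q), q₂] : Conf 2) =
      !₂[-lam * q + 0 * q₂, 0 * q + 1 * q₂] := by
    congr 2 <;> ring_nf
  have h_det : |-lam * 1 - 0 * 0| = lam := by simp [abs_of_pos hlam]
  refine isDensityOf_map_mix_linear (P := σ.posLaw) σ (fun i => measurable_coeFn (σ.vec i))
    (measurable_noiseQ lam 0 kap) hlam h_det (fun q q₂ => ?_) rfl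
    (fun q => by simp only [noiseE0, h_arg])
  simp only [noiseQ, Matrix.cons_val_zero, Matrix.cons_val_one]
  field_simp
  ring

theorem isDensityOf_noiseF0 (hmu : 0 < mu) (kap : ℝ) (σ : ProbeState ι) :
    IsDensityOf (noiseF0 mu σ) (σ.momLaw.map (noiseP 0 mu kap)) := by
  have h_arg (p p₁ : ℝ) : (!₂[p₁, -(mu * p)] : Conf 2) =
      !₂[0 * p + 1 * p₁, -mu * p + 0 * p₁] := by
    congr 2 <;> ring_nf
  have h_det : |0 * 0 - 1 * -mu| = mu := by simp [abs_of_pos hmu]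
  refine isDensityOf_map_mix_linear (P := σ.momLaw) σ (fun i => measurable_momWave (σ.vec i))
    (measurable_noiseP 0 mu kap) hmu h_det (fun p p₁ => ?_) rfl
    (fun p => by simp only [noiseF0, h_arg])
  simp only [noiseP, Matrix.cons_val_zero, Matrix.cons_val_one]
  field_simp
  ring

end NoiseDensities

namespace IsDensityOf

variable {e : ℝ → ℝ} {N : Measure ℝ}

theorem integrable_iff (h : IsDensityOf e N) {g : ℝ → ℝ} :
    Integrable g N ↔ Integrable fun q => g q * e q := by
  rw [h.2.2, integrable_withDensity_iff_integrable_smul₀' h.2.1.ennreal_ofReal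
    (.of_forall fun _ => ENNReal.ofReal_lt_top)]
  simp only [ENNReal.toReal_ofReal (h.1 _), smul_eq_mul, mul_comm]

theorem integral_eq (h : IsDensityOf e N) (g : ℝ → ℝ) : ∫ q, g q ∂N = ∫ q, g q * e q := by
  rw [h.2.2, integral_withDensity_eq_integral_toReal_smul₀ h.2.1.ennreal_ofReal
    (.of_forall fun _ => ENNReal.ofReal_lt_top)]
  simp only [ENNReal.toReal_ofReal (h.1 _), smul_eq_mul, mul_comm]

theorem isProbDensity [IsProbabilityMeasure N] (h : IsDensityOf e N) : IsProbDensity e := by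
  refine ⟨h.1, ?_, ?_⟩
  · simpa using (h.integrable_iff (g := fun _ => 1)).1 (integrable_const 1)
  · simpa using (h.integral_eq fun _ => 1).symm

theorem smear_eq (h : IsDensityOf e N) {X : Set ℝ} (hX : MeasurableSet X) (a : ℝ) :
    smear X e a = N.real {t | a - t ∈ X} := by
  have hS : MeasurableSet {t | a - t ∈ X} := measurable_const.sub measurable_id hX
  have h_reflect := integral_sub_left_eq_self
    (fun t => X.indicator (fun _ => (1 : ℝ)) (a - t) * e t) volume a
  simp only [sub_sub_cancel] at h_reflect
  rw [← integral_indicator_one hS, h.integral_eq]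
  exact h_reflect

theorem densityVar_eq_variance_id (h : IsDensityOf e N) : densityVar e = Var[id; N] := by
  rw [variance_eq_integral aemeasurable_id, densityVar, h.integral_eq, h.integral_eq]
  rfl

section Map

variable {Ω : Type*} [MeasurableSpace Ω] {P : Measure Ω} {n : Ω → ℝ}

theorem integrable_mul_iff (h : IsDensityOf e (P.map n)) (hn : Measurable n) {g : ℝ → ℝ}
    (hg : Measurable g) :
    Integrable (fun q => g q * e q) ↔ Integrable (fun y => g (n y)) P :=
  h.integrable_iff.symm.trans
    (integrable_map_measure hg.aestronglyMeasurable hn.aemeasurable)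

theorem integral_mul (h : IsDensityOf e (P.map n)) (hn : Measurable n) {g : ℝ → ℝ}
    (hg : Measurable g) : ∫ q, g q * e q = ∫ y, g (n y) ∂P :=
  (h.integral_eq g).symm.trans (integral_map hn.aemeasurable hg.aestronglyMeasurable)

theorem moment1_eq (h : IsDensityOf e (P.map n)) (hn : Measurable n) :
    moment1 e = ∫ y, n y ∂P :=
  h.integral_mul hn measurable_id

theorem moment2_eq (h : IsDensityOf e (P.map n)) (hn : Measurable n) :
    moment2 e = ∫ y, n y ^ 2 ∂P :=
  h.integral_mul hn (measurable_id.pow_const 2)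

theorem densityVar_eq (h : IsDensityOf e (P.map n)) (hn : Measurable n) :
    densityVar e = Var[n; P] := by
  rw [h.densityVar_eq_variance_id, variance_id_map hn.aemeasurable]

end Map

end IsDensityOf

/-! ### Consequences of a noise law -/

theorem measurable_smear {e : ℝ → ℝ} {N : Measure ℝ} [SFinite N] (h : IsDensityOf e N) {X : Set ℝ}
    (hX : MeasurableSet X) : Measurable (smear X e) := by
  have h_sub : MeasurableSet {z : ℝ × ℝ | z.1 - z.2 ∈ X} := measurable_fst.sub measurable_snd hX
  rw [show smear X e = fun a => N.real {t | a - t ∈ X} from funext (h.smear_eq hX)]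
  exact (measurable_measure_prodMk_left (ν := N) h_sub).ennreal_toReal

theorem abs_smear_le_one {e : ℝ → ℝ} {N : Measure ℝ} [IsProbabilityMeasure N]
    (h : IsDensityOf e N) {X : Set ℝ} (hX : MeasurableSet X) (a : ℝ) : |smear X e a| ≤ 1 := by
  rw [h.smear_eq hX, abs_of_nonneg measureReal_nonneg]
  exact measureReal_le_one

theorem diffLaw_real_eq_integral_smear {e : ℝ → ℝ} (ρ : Measure ℝ) {N : Measure ℝ}
    [IsFiniteMeasure N] (h : IsDensityOf e N) {X : Set ℝ} (hX : MeasurableSet X) :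
    (diffLaw ρ N).real X = ∫ a, smear X e a ∂ρ := by
  have h_diff : Measurable fun z : ℝ × ℝ => z.1 - z.2 := by fun_prop
  rw [measureReal_def, diffLaw, Measure.map_apply h_diff hX, Measure.prod_apply (h_diff hX),
    ← integral_toReal (measurable_measure_prodMk_left (h_diff hX)).aemeasurable
      (.of_forall fun _ => measure_lt_top _ _)]
  exact integral_congr_ae (.of_forall fun a => (h.smear_eq hX a).symm)

theorem memLp_two_id_iff {ρ : Measure ℝ} : MemLp id 2 ρ ↔ Integrable (fun x => x ^ 2) ρ :=
  memLp_two_iff_integrable_sq aestronglyMeasurable_id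

theorem memLp_two_diffLaw {ρ N : Measure ℝ} [IsFiniteMeasure ρ] [IsFiniteMeasure N]
    (hρ : MemLp id 2 ρ) (hN : MemLp id 2 N) : MemLp id 2 (diffLaw ρ N) := by
  rw [diffLaw, memLp_map_measure_iff aestronglyMeasurable_id (by fun_prop)]
  exact (hρ.comp_fst N).sub (hN.comp_snd ρ)

theorem variance_diffLaw {ρ N : Measure ℝ} [IsProbabilityMeasure ρ] [IsProbabilityMeasure N]
    (hρ : MemLp id 2 ρ) (hN : MemLp id 2 N) :
    Var[id; diffLaw ρ N] = Var[id; ρ] + Var[id; N] := by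
  rw [diffLaw, variance_id_map (by fun_prop),
    ← variance_neg (X := id) (μ := N), ← variance_add_prod hρ hN.neg]
  simp only [id, Pi.neg_apply, sub_eq_add_neg]

section OutcomeLaw

variable {A : Set ℝ → (L2 ℝ →L[ℂ] L2 ℝ)} {ψ : L2 ℝ}

theorem IsOutcomeLaw.eq {ν ν' : Measure ℝ} (h : IsOutcomeLaw A ψ ν) (h' : IsOutcomeLaw A ψ ν') :
    ν = ν' := by
  have := h.1
  have := h'.1
  ext X hX
  rw [← measureReal_eq_measureReal_iff]
  exact Complex.ofReal_injective ((h.2 X hX).trans (h'.2 X hX).symm)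

theorem IsOutcomeLaw.outcomeLaw_eq {ν : Measure ℝ} (h : IsOutcomeLaw A ψ ν) :
    outcomeLaw A ψ = ν :=
  IsOutcomeLaw.eq (Classical.epsilon_spec ⟨ν, h⟩) h

theorem IsOutcomeLaw.obsVar_eq {ν : Measure ℝ} (h : IsOutcomeLaw A ψ ν) :
    obsVar A ψ = Var[id; ν] := by
  rw [variance_eq_integral aemeasurable_id, obsVar, h.outcomeLaw_eq]
  rfl

end OutcomeLaw

namespace HasNoiseLaw

variable {law : L2 ℝ → Measure ℝ} {A : Set ℝ → (L2 ℝ →L[ℂ] L2 ℝ)} {N : Measure ℝ}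
  [IsProbabilityMeasure N]

theorem isFunOfPos (hA : HasNoiseLaw posLaw A N) {e : ℝ → ℝ} (h : IsDensityOf e N) {X : Set ℝ}
    (hX : MeasurableSet X) : IsFunOfPos (A X) (smear X e) :=
  isFunOfPos_of_inner (measurable_smear h hX) (abs_smear_le_one h hX) fun ψ => by
    rw [hA X hX ψ, diffLaw_real_eq_integral_smear _ h hX]

theorem isFunOfMom (hA : HasNoiseLaw momLaw A N) {e : ℝ → ℝ} (h : IsDensityOf e N) {Y : Set ℝ}
    (hY : MeasurableSet Y) : IsFunOfMom (A Y) (smear Y e) :=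
  isFunOfMom_of_inner (measurable_smear h hY) (abs_smear_le_one h hY) fun ψ => by
    rw [hA Y hY ψ, diffLaw_real_eq_integral_smear _ h hY]

variable {ψ : L2 ℝ} [IsProbabilityMeasure (law ψ)]

theorem isOutcomeLaw (hA : HasNoiseLaw law A N) : IsOutcomeLaw A ψ (diffLaw (law ψ) N) :=
  ⟨inferInstance, fun X hX => (hA X hX ψ).symm⟩

theorem hasFiniteVar (hA : HasNoiseLaw law A N) (hψ : Integrable (fun x => x ^ 2) (law ψ))
    (hN : Integrable (fun x => x ^ 2) N) :
    HasFiniteVar A ψ := by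
  refine ⟨⟨_, hA.isOutcomeLaw, fun ν hν => hν.eq hA.isOutcomeLaw⟩, ?_⟩
  rw [hA.isOutcomeLaw.outcomeLaw_eq]
  exact (memLp_two_diffLaw (memLp_two_id_iff.2 hψ) (memLp_two_id_iff.2 hN)).integrable_sq

theorem obsVar_eq (hA : HasNoiseLaw law A N) (hψ : Integrable (fun x => x ^ 2) (law ψ))
    (hN : Integrable (fun x => x ^ 2) N) :
    obsVar A ψ = Var[id; law ψ] + Var[id; N] := by
  rw [hA.isOutcomeLaw.obsVar_eq, variance_diffLaw (memLp_two_id_iff.2 hψ) (memLp_two_id_iff.2 hN)]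

theorem obsVar_sub (hA : HasNoiseLaw law A N) {A' : Set ℝ → (L2 ℝ →L[ℂ] L2 ℝ)} {N' : Measure ℝ}
    [IsProbabilityMeasure N'] (hA' : HasNoiseLaw law A' N')
    (hψ : Integrable (fun x => x ^ 2) (law ψ))
    (hN : Integrable (fun x => x ^ 2) N) (hN' : Integrable (fun x => x ^ 2) N') :
    obsVar A ψ - obsVar A' ψ = Var[id; N] - Var[id; N'] := by
  rw [hA.obsVar_eq hψ hN, hA'.obsVar_eq hψ hN', add_sub_add_left_eq_sub]

end HasNoiseLaw

/-! ### Moments of the noise -/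

section LinearCombination

variable {Ω : Type*} [MeasurableSpace Ω] {P : Measure Ω} {X Y : Ω → ℝ}

theorem integral_const_mul_sub_const_mul (hX : Integrable X P) (hY : Integrable Y P) (a b : ℝ) :
    ∫ ω, (a * X ω - b * Y ω) ∂P = a * ∫ ω, X ω ∂P - b * ∫ ω, Y ω ∂P := by
  rw [integral_sub (hX.const_mul a) (hY.const_mul b), integral_const_mul, integral_const_mul]

theorem integral_sq_const_mul_sub_const_mul (hX : MemLp X 2 P) (hY : MemLp Y 2 P) (a b : ℝ) :
    ∫ ω, (a * X ω - b * Y ω) ^ 2 ∂P =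
      a ^ 2 * ∫ ω, X ω ^ 2 ∂P + b ^ 2 * ∫ ω, Y ω ^ 2 ∂P - 2 * a * b * ∫ ω, X ω * Y ω ∂P := by
  have hXX := hX.integrable_sq.const_mul (a ^ 2)
  have hYY := hY.integrable_sq.const_mul (b ^ 2)
  have hXY : Integrable (fun ω => 2 * a * b * (X ω * Y ω)) P :=
    (hX.integrable_mul hY).const_mul (2 * a * b)
  rw [← integral_const_mul, ← integral_const_mul, ← integral_const_mul, ← integral_add hXX hYY,
    ← integral_sub (by exact hXX.add hYY) hXY]
  congr 1 with ω
  ring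

theorem variance_const_mul_sub_const_mul [IsProbabilityMeasure P] (hX : MemLp X 2 P)
    (hY : MemLp Y 2 P) (a b : ℝ) :
    Var[fun ω => a * X ω - b * Y ω; P] =
      a ^ 2 * Var[X; P] + b ^ 2 * Var[Y; P] - 2 * a * b * cov[X, Y; P] := by
  rw [variance_fun_sub (hX.const_mul a) (hY.const_mul b),
    variance_const_mul, variance_const_mul,
    covariance_const_mul_left, covariance_const_mul_right]
  ring

end LinearCombination

namespace ProbeState

variable {ι : Type*} {σ : ProbeState ι}

theorem SecondMomentsQ.memLp (hQ : σ.SecondMomentsQ) (j : Fin 2) :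
    MemLp (fun x : Conf 2 => x j) 2 σ.posLaw :=
  (memLp_two_iff_integrable_sq (by fun_prop)).2 (hQ j)

theorem SecondMomentsP.memLp (hP : σ.SecondMomentsP) (j : Fin 2) :
    MemLp (fun p : Conf 2 => p j) 2 σ.momLaw :=
  (memLp_two_iff_integrable_sq (by fun_prop)).2 (hP j)

theorem SecondMomentsQ.varQ_eq (hQ : σ.SecondMomentsQ) (j : Fin 2) :
    σ.varQ j = Var[fun x => x j; σ.posLaw] :=
  (variance_eq_sub (hQ.memLp j)).symm

theorem SecondMomentsP.varP_eq (hP : σ.SecondMomentsP) (j : Fin 2) :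
    σ.varP j = Var[fun p => p j; σ.momLaw] :=
  (variance_eq_sub (hP.memLp j)).symm

theorem SecondMomentsQ.covQ_eq (hQ : σ.SecondMomentsQ) :
    σ.covQ = cov[fun x => x 0, fun x => x 1; σ.posLaw] :=
  (covariance_eq_sub (hQ.memLp 0) (hQ.memLp 1)).symm

theorem SecondMomentsP.covP_eq (hP : σ.SecondMomentsP) :
    σ.covP = cov[fun p => p 0, fun p => p 1; σ.momLaw] :=
  (covariance_eq_sub (hP.memLp 0) (hP.memLp 1)).symm

variable (lam mu kap : ℝ)

theorem SecondMomentsQ.memLp_noiseQ (hQ : σ.SecondMomentsQ) :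
    MemLp (noiseQ lam mu kap) 2 σ.posLaw :=
  ((hQ.memLp 1).const_mul _).sub ((hQ.memLp 0).const_mul _)

theorem SecondMomentsP.memLp_noiseP (hP : σ.SecondMomentsP) :
    MemLp (noiseP lam mu kap) 2 σ.momLaw :=
  ((hP.memLp 0).const_mul _).sub ((hP.memLp 1).const_mul _)

theorem SecondMomentsQ.integrable_sq_map_noiseQ (hQ : σ.SecondMomentsQ) :
    Integrable (fun q => q ^ 2) (σ.posLaw.map (noiseQ lam mu kap)) :=
  (integrable_map_measure (by fun_prop) (by fun_prop)).2 (hQ.memLp_noiseQ lam mu kap).integrable_sq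

theorem SecondMomentsP.integrable_sq_map_noiseP (hP : σ.SecondMomentsP) :
    Integrable (fun p => p ^ 2) (σ.momLaw.map (noiseP lam mu kap)) :=
  (integrable_map_measure (by fun_prop) (by fun_prop)).2 (hP.memLp_noiseP lam mu kap).integrable_sq

theorem SecondMomentsQ.variance_noiseQ (hQ : σ.SecondMomentsQ) :
    Var[noiseQ lam mu kap; σ.posLaw] =
      1 / lam ^ 2 * σ.varQ 0 + mu ^ 2 / 4 * (1 - kap) ^ 2 * σ.varQ 1
        - mu / lam * (1 - kap) * σ.covQ := by
  rw [show noiseQ lam mu kap = fun y => mu / 2 * (1 - kap) * y 1 - 1 / lam * y 0 from rfl,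
    variance_const_mul_sub_const_mul (hQ.memLp 1) (hQ.memLp 0),
    covariance_comm, ← hQ.varQ_eq, ← hQ.varQ_eq, ← hQ.covQ_eq]
  ring

theorem SecondMomentsP.variance_noiseP (hP : σ.SecondMomentsP) :
    Var[noiseP lam mu kap; σ.momLaw] =
      lam ^ 2 / 4 * (1 + kap) ^ 2 * σ.varP 0 + 1 / mu ^ 2 * σ.varP 1
        - lam / mu * (1 + kap) * σ.covP := by
  rw [show noiseP lam mu kap = fun p => lam / 2 * (1 + kap) * p 0 - 1 / mu * p 1 from rfl,
    variance_const_mul_sub_const_mul (hP.memLp 0) (hP.memLp 1), ← hP.varP_eq, ← hP.varP_eq,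
    ← hP.covP_eq]
  ring

instance isProbabilityMeasure_noiseQ : IsProbabilityMeasure (σ.posLaw.map (noiseQ lam mu kap)) :=
  Measure.isProbabilityMeasure_map (by fun_prop)

instance isProbabilityMeasure_noiseP : IsProbabilityMeasure (σ.momLaw.map (noiseP lam mu kap)) :=
  Measure.isProbabilityMeasure_map (by fun_prop)

end ProbeState

section NoiseMoments

variable {ι : Type*} [Countable ι] {σ : ProbeState ι} {lam mu : ℝ} (kap : ℝ)

theorem integrable_mul_noiseE (hlam : 0 < lam) (hmu : 0 < mu) (hQ : σ.FirstMomentsQ) :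
    Integrable fun q => q * noiseE lam mu kap σ q :=
  ((isDensityOf_noiseE hlam hmu kap σ).integrable_mul_iff (by fun_prop) measurable_id).2
    (((hQ 1).const_mul _).sub ((hQ 0).const_mul _))

theorem integrable_mul_noiseF (hlam : 0 < lam) (hmu : 0 < mu) (hP : σ.FirstMomentsP) :
    Integrable fun p => p * noiseF lam mu kap σ p :=
  ((isDensityOf_noiseF hlam hmu kap σ).integrable_mul_iff (by fun_prop) measurable_id).2
    (((hP 0).const_mul _).sub ((hP 1).const_mul _))

theorem moment1_noiseE (hlam : 0 < lam) (hmu : 0 < mu) (hQ : σ.FirstMomentsQ) :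
    moment1 (noiseE lam mu kap σ) =
      mu / 2 * (1 - kap) * σ.avgQ (fun x => x 1) - 1 / lam * σ.avgQ (fun x => x 0) :=
  ((isDensityOf_noiseE hlam hmu kap σ).moment1_eq (by fun_prop)).trans
    (integral_const_mul_sub_const_mul (hQ 1) (hQ 0) _ _)

theorem moment1_noiseF (hlam : 0 < lam) (hmu : 0 < mu) (hP : σ.FirstMomentsP) :
    moment1 (noiseF lam mu kap σ) =
      lam / 2 * (1 + kap) * σ.avgP (fun p => p 0) - 1 / mu * σ.avgP (fun p => p 1) :=
  ((isDensityOf_noiseF hlam hmu kap σ).moment1_eq (by fun_prop)).trans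
    (integral_const_mul_sub_const_mul (hP 0) (hP 1) _ _)

theorem integrable_sq_mul_noiseE (hlam : 0 < lam) (hmu : 0 < mu) (hQ : σ.SecondMomentsQ) :
    Integrable fun q => q ^ 2 * noiseE lam mu kap σ q :=
  (isDensityOf_noiseE hlam hmu kap σ).integrable_iff.1 (hQ.integrable_sq_map_noiseQ lam mu kap)

theorem integrable_sq_mul_noiseF (hlam : 0 < lam) (hmu : 0 < mu) (hP : σ.SecondMomentsP) :
    Integrable fun p => p ^ 2 * noiseF lam mu kap σ p :=
  (isDensityOf_noiseF hlam hmu kap σ).integrable_iff.1 (hP.integrable_sq_map_noiseP lam mu kap)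

theorem integrable_sq_mul_noiseE0 (hlam : 0 < lam) (hQ : σ.SecondMomentsQ) :
    Integrable fun q => q ^ 2 * noiseE0 lam σ q :=
  (isDensityOf_noiseE0 hlam 0 σ).integrable_iff.1 (hQ.integrable_sq_map_noiseQ lam 0 0)

theorem integrable_sq_mul_noiseF0 (hmu : 0 < mu) (hP : σ.SecondMomentsP) :
    Integrable fun p => p ^ 2 * noiseF0 mu σ p :=
  (isDensityOf_noiseF0 hmu 0 σ).integrable_iff.1 (hP.integrable_sq_map_noiseP 0 mu 0)

theorem moment2_noiseE (hlam : 0 < lam) (hmu : 0 < mu) (hQ : σ.SecondMomentsQ) :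
    moment2 (noiseE lam mu kap σ) =
      mu ^ 2 / 4 * (1 - kap) ^ 2 * σ.avgQ (fun x => x 1 ^ 2)
        + 1 / lam ^ 2 * σ.avgQ (fun x => x 0 ^ 2)
        - mu / lam * (1 - kap) * σ.avgQ (fun x => x 0 * x 1) := by
  rw [(isDensityOf_noiseE hlam hmu kap σ).moment2_eq (by fun_prop)]
  simp only [noiseQ]
  rw [integral_sq_const_mul_sub_const_mul (hQ.memLp 1) (hQ.memLp 0)]
  simp only [ProbeState.avgQ, mul_comm]
  ring

theorem moment2_noiseF (hlam : 0 < lam) (hmu : 0 < mu) (hP : σ.SecondMomentsP) :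
    moment2 (noiseF lam mu kap σ) =
      lam ^ 2 / 4 * (1 + kap) ^ 2 * σ.avgP (fun p => p 0 ^ 2)
        + 1 / mu ^ 2 * σ.avgP (fun p => p 1 ^ 2)
        - lam / mu * (1 + kap) * σ.avgP (fun p => p 0 * p 1) := by
  rw [(isDensityOf_noiseF hlam hmu kap σ).moment2_eq (by fun_prop)]
  simp only [noiseP]
  rw [integral_sq_const_mul_sub_const_mul (hP.memLp 0) (hP.memLp 1)]
  simp only [ProbeState.avgP]
  ring

theorem densityVar_noiseE (hlam : 0 < lam) (hmu : 0 < mu) (hQ : σ.SecondMomentsQ) :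
    densityVar (noiseE lam mu kap σ) =
      1 / lam ^ 2 * σ.varQ 0 + mu ^ 2 / 4 * (1 - kap) ^ 2 * σ.varQ 1
        - mu / lam * (1 - kap) * σ.covQ := by
  rw [(isDensityOf_noiseE hlam hmu kap σ).densityVar_eq (by fun_prop), hQ.variance_noiseQ]

theorem densityVar_noiseF (hlam : 0 < lam) (hmu : 0 < mu) (hP : σ.SecondMomentsP) :
    densityVar (noiseF lam mu kap σ) =
      lam ^ 2 / 4 * (1 + kap) ^ 2 * σ.varP 0 + 1 / mu ^ 2 * σ.varP 1
        - lam / mu * (1 + kap) * σ.covP := by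
  rw [(isDensityOf_noiseF hlam hmu kap σ).densityVar_eq (by fun_prop), hP.variance_noiseP]

theorem densityVar_noiseE0 (hlam : 0 < lam) (hQ : σ.SecondMomentsQ) :
    densityVar (noiseE0 lam σ) = 1 / lam ^ 2 * σ.varQ 0 := by
  rw [(isDensityOf_noiseE0 hlam 0 σ).densityVar_eq (by fun_prop), hQ.variance_noiseQ]
  ring

theorem densityVar_noiseF0 (hmu : 0 < mu) (hP : σ.SecondMomentsP) :
    densityVar (noiseF0 mu σ) = 1 / mu ^ 2 * σ.varP 1 := by
  rw [(isDensityOf_noiseF0 hmu 0 σ).densityVar_eq (by fun_prop), hP.variance_noiseP]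
  ring

end NoiseMoments

/-! ### The disturbances -/

section Disturbance

variable {ι : Type*} [Countable ι] {σ : ProbeState ι} {lam mu : ℝ} (kap : ℝ) {ψ : L2 ℝ}

theorem hasFiniteVar_obsE (hlam : lam ≠ 0) (hmu : mu ≠ 0) (hQ : σ.SecondMomentsQ) (hψ : ‖ψ‖ = 1)
    (hψ₂ : Integrable (fun x => x ^ 2) (posLaw ψ)) : HasFiniteVar (obsE lam mu kap σ) ψ :=
  have := isProbabilityMeasure_posLaw hψ
  (hasNoiseLaw_obsE σ kap hlam hmu).hasFiniteVar hψ₂ (hQ.integrable_sq_map_noiseQ lam mu kap)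

theorem hasFiniteVar_obsF (hlam : lam ≠ 0) (hmu : mu ≠ 0) (hP : σ.SecondMomentsP) (hψ : ‖ψ‖ = 1)
    (hψ₂ : Integrable (fun p => p ^ 2) (momLaw ψ)) : HasFiniteVar (obsF lam mu kap σ) ψ :=
  have := isProbabilityMeasure_momLaw hψ
  (hasNoiseLaw_obsF σ kap hlam hmu).hasFiniteVar hψ₂ (hP.integrable_sq_map_noiseP lam mu kap)

theorem hasFiniteVar_obsE0 (hlam : lam ≠ 0) (hQ : σ.SecondMomentsQ) (hψ : ‖ψ‖ = 1)
    (hψ₂ : Integrable (fun x => x ^ 2) (posLaw ψ)) : HasFiniteVar (obsE0 lam kap σ) ψ :=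
  have := isProbabilityMeasure_posLaw hψ
  (hasNoiseLaw_obsE0 σ kap hlam).hasFiniteVar hψ₂ (hQ.integrable_sq_map_noiseQ lam 0 kap)

theorem hasFiniteVar_obsF0 (hmu : mu ≠ 0) (hP : σ.SecondMomentsP) (hψ : ‖ψ‖ = 1)
    (hψ₂ : Integrable (fun p => p ^ 2) (momLaw ψ)) : HasFiniteVar (obsF0 mu kap σ) ψ :=
  have := isProbabilityMeasure_momLaw hψ
  (hasNoiseLaw_obsF0 σ kap hmu).hasFiniteVar hψ₂ (hP.integrable_sq_map_noiseP 0 mu kap)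

theorem deltaQ_eq_densityVar_sub (hlam : 0 < lam) (hmu : 0 < mu) (hQ : σ.SecondMomentsQ)
    (hψ : ‖ψ‖ = 1) (hψ₂ : Integrable (fun x => x ^ 2) (posLaw ψ)) :
    deltaQ lam mu kap σ ψ = densityVar (noiseE lam mu kap σ) - densityVar (noiseE0 lam σ) := by
  have := isProbabilityMeasure_posLaw hψ
  rw [deltaQ, (hasNoiseLaw_obsE σ kap hlam.ne' hmu.ne').obsVar_sub
      (hasNoiseLaw_obsE0 σ kap hlam.ne') hψ₂ (hQ.integrable_sq_map_noiseQ lam mu kap)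
      (hQ.integrable_sq_map_noiseQ lam 0 kap),
    (isDensityOf_noiseE hlam hmu kap σ).densityVar_eq_variance_id,
    (isDensityOf_noiseE0 hlam kap σ).densityVar_eq_variance_id]

theorem deltaP_eq_densityVar_sub (hlam : 0 < lam) (hmu : 0 < mu) (hP : σ.SecondMomentsP)
    (hψ : ‖ψ‖ = 1) (hψ₂ : Integrable (fun p => p ^ 2) (momLaw ψ)) :
    deltaP lam mu kap σ ψ = densityVar (noiseF lam mu kap σ) - densityVar (noiseF0 mu σ) := by
  have := isProbabilityMeasure_momLaw hψ
  rw [deltaP, (hasNoiseLaw_obsF σ kap hlam.ne' hmu.ne').obsVar_sub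
      (hasNoiseLaw_obsF0 σ kap hmu.ne') hψ₂ (hP.integrable_sq_map_noiseP lam mu kap)
      (hP.integrable_sq_map_noiseP 0 mu kap),
    (isDensityOf_noiseF hlam hmu kap σ).densityVar_eq_variance_id,
    (isDensityOf_noiseF0 hmu kap σ).densityVar_eq_variance_id]

theorem deltaQ_eq (hlam : 0 < lam) (hmu : 0 < mu) (hQ : σ.SecondMomentsQ) (hψ : ‖ψ‖ = 1)
    (hψ₂ : Integrable (fun x => x ^ 2) (posLaw ψ)) :
    deltaQ lam mu kap σ ψ =
      (1 - kap) ^ 2 / 4 * mu ^ 2 * σ.varQ 1 - (1 - kap) / lam * mu * σ.covQ := by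
  rw [deltaQ_eq_densityVar_sub kap hlam hmu hQ hψ hψ₂, densityVar_noiseE kap hlam hmu hQ,
    densityVar_noiseE0 hlam hQ]
  ring

theorem deltaP_eq (hlam : 0 < lam) (hmu : 0 < mu) (hP : σ.SecondMomentsP) (hψ : ‖ψ‖ = 1)
    (hψ₂ : Integrable (fun p => p ^ 2) (momLaw ψ)) :
    deltaP lam mu kap σ ψ =
      (1 + kap) ^ 2 / 4 * lam ^ 2 * σ.varP 0 - (1 + kap) / mu * lam * σ.covP := by
  rw [deltaP_eq_densityVar_sub kap hlam hmu hP hψ hψ₂, densityVar_noiseF kap hlam hmu hP,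
    densityVar_noiseF0 hmu hP]
  ring

end Disturbance

/-! ### Phase space displacements -/

section Displacement

variable {E : Type*} [NormedAddCommGroup E] [InnerProductSpace ℝ E]

/-- The wave function `f` displaced by `v` in position and by `2πη` in momentum. -/
def displace (v η : E) (f : E → ℂ) (x : E) : ℂ := 𝐞 (inner ℝ η x) • f (x - v)

theorem norm_displace (v η : E) (f : E → ℂ) (x : E) : ‖displace v η f x‖ = ‖f (x - v)‖ :=
  Circle.norm_smul _ _

variable [FiniteDimensional ℝ E] [MeasurableSpace E] [BorelSpace E]

theorem aestronglyMeasurable_displace (v η : E) {f : E → ℂ}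
    (hf : AEStronglyMeasurable f volume) : AEStronglyMeasurable (displace v η f) volume :=
  (Real.continuous_fourierChar.comp (by fun_prop)).aestronglyMeasurable.smul
    (hf.comp_measurePreserving (measurePreserving_sub_right volume v))

theorem eLpNorm_displace (v η : E) {f : E → ℂ} (hf : AEStronglyMeasurable f volume)
    (p : ℝ≥0∞) : eLpNorm (displace v η f) p volume = eLpNorm f p volume :=
  (eLpNorm_congr_norm_ae (.of_forall (norm_displace v η f))).trans
    (eLpNorm_comp_measurePreserving hf (measurePreserving_sub_right volume v))

theorem memLp_displace (v η : E) {f : E → ℂ} {p : ℝ≥0∞} (hf : MemLp f p volume) :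
    MemLp (displace v η f) p volume :=
  ⟨aestronglyMeasurable_displace v η hf.1, (eLpNorm_displace v η hf.1 p).trans_lt hf.2⟩

theorem norm_toLp_displace (v η : E) {f : E → ℂ} (hf : MemLp f 2 volume) :
    ‖(memLp_displace v η hf).toLp‖ = ‖hf.toLp‖ := by
  rw [Lp.norm_toLp, Lp.norm_toLp, eLpNorm_displace v η hf.1]

theorem fourier_displace (v η : E) (f : E → ℂ) (ξ : E) :
    𝓕 (displace v η f) ξ = 𝐞 (-inner ℝ v (ξ - η)) • 𝓕 f (ξ - η) := by
  rw [Real.fourier_eq, Real.fourier_eq, Circle.smul_def, ← integral_smul,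
    ← integral_sub_right_eq_self (fun y => (𝐞 (-inner ℝ v (ξ - η)) : ℂ) •
      𝐞 (-inner ℝ y (ξ - η)) • f y) v]
  congr 1 with x
  simp only [displace, ← Circle.smul_def, smul_smul, ← AddChar.map_add_eq_mul]
  congr 2
  simp only [inner_sub_left, inner_sub_right, real_inner_comm η x]
  ring

theorem posLaw_eq_map_add {φ χ : L2 E} {v : E} (h : ∀ᵐ x, ‖χ x‖ = ‖φ (x - v)‖) :
    posLaw χ = (posLaw φ).map (· + v) := by
  have h_map := map_withDensity_comp (μ := (volume : Measure E)) (measurable_add_const v)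
    (((measurable_coeFn φ).comp (measurable_sub_const v)).enorm.pow_const 2)
  simp only [Function.comp_apply, add_sub_cancel_right, map_add_right_eq_self] at h_map
  rw [posLaw, posLaw, h_map]
  refine withDensity_congr_ae (h.mono fun x hx => ?_)
  simp only [← ofReal_norm, hx]

theorem ae_sub_const {p : E → Prop} (h : ∀ᵐ x, p x) (v : E) : ∀ᵐ x, p (x - v) :=
  (measurePreserving_sub_right volume v).quasiMeasurePreserving.ae h

theorem posLaw_displace (v η : E) {f : E → ℂ} (hf : MemLp f 2 volume) :
    posLaw (memLp_displace v η hf).toLp = (posLaw hf.toLp).map (· + v) := by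
  refine posLaw_eq_map_add ?_
  filter_upwards [(memLp_displace v η hf).coeFn_toLp, ae_sub_const hf.coeFn_toLp v]
    with x hx hx'
  rw [hx, hx', norm_displace]

theorem momLaw_displace (v η : E) {f : E → ℂ} (hf₁ : Integrable f) (hf₂ : MemLp f 2 volume) :
    momLaw (memLp_displace v η hf₂).toLp =
      (momLaw hf₂.toLp).map (· + (2 * Real.pi) • η) := by
  have h_integrable : Integrable (displace v η f) :=
    memLp_one_iff_integrable.1 (memLp_displace v η (memLp_one_iff_integrable.2 hf₁))
  have h_norm : ∀ᵐ ξ, ‖(Lp.fourierTransformₗᵢ E ℂ (memLp_displace v η hf₂).toLp : L2 E) ξ‖ =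
      ‖(Lp.fourierTransformₗᵢ E ℂ hf₂.toLp : L2 E) (ξ - η)‖ := by
    filter_upwards [fourierTransform_toLp_ae_eq h_integrable (memLp_displace v η hf₂),
      ae_sub_const (fourierTransform_toLp_ae_eq hf₁ hf₂) η] with ξ hξ hξ'
    rw [hξ, hξ', fourier_displace, Circle.norm_smul]
  rw [momLaw_eq_map, momLaw_eq_map, posLaw_eq_map_add h_norm,
    Measure.map_map (by fun_prop) (by fun_prop), Measure.map_map (by fun_prop) (by fun_prop)]
  simp only [Function.comp_def, smul_add]

theorem exists_schwartz_norm_toLp_eq_one (E : Type*) [NormedAddCommGroup E]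
    [InnerProductSpace ℝ E] [FiniteDimensional ℝ E] [MeasurableSpace E] [BorelSpace E] :
    ∃ f : 𝓢(E, ℂ), ‖f.toLp 2 volume‖ = 1 := by
  let b : ContDiffBump (0 : E) := ⟨1, 2, one_pos, one_lt_two⟩
  have h_compact : HasCompactSupport (Complex.ofRealCLM ∘ b) := b.hasCompactSupport.comp_left rfl
  let g : 𝓢(E, ℂ) := h_compact.toSchwartzMap (Complex.ofRealCLM.contDiff.comp b.contDiff)
  have hg : g ≠ 0 := by
    have hg₀ : g 0 = 1 := congrArg Complex.ofReal (b.one_of_mem_closedBall (by simp [b]))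
    intro h
    simp [h] at hg₀
  let T := SchwartzMap.toLpCLM ℂ (E := E) ℂ 2 volume
  have hTg : T g ≠ 0 := fun h =>
    hg (SchwartzMap.injective_toLp 2 volume (h.trans (map_zero T).symm))
  refine ⟨((‖T g‖⁻¹ : ℝ) : ℂ) • g, ?_⟩
  change ‖T (((‖T g‖⁻¹ : ℝ) : ℂ) • g)‖ = 1
  rw [map_smul, norm_smul, Complex.norm_real, norm_inv, norm_norm,
    inv_mul_cancel₀ (norm_ne_zero_iff.2 hTg)]

end Displacement

theorem memLp_coord_posLaw_toLp {n : ℕ} (f : 𝓢(Conf n, ℂ)) (j : Fin n) :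
    MemLp (fun x : Conf n => x j) 2 (posLaw (f.toLp 2 volume)) := by
  rw [memLp_two_iff_integrable_sq (by fun_prop), posLaw_eq_of_ae_eq (f.coeFn_toLp 2 volume),
    integrable_withDensity_iff_integrable_smul₀' (by fun_prop)
      (.of_forall fun x => by simp [enorm_lt_top])]
  refine ((posOp j f).memLp 2 volume).integrable_norm_pow two_ne_zero |>.congr
    (.of_forall fun x => ?_)
  simp only [posOp_apply, norm_mul, mul_pow, Complex.norm_real, Real.norm_eq_abs, sq_abs,
    ENNReal.toReal_pow, toReal_enorm, smul_eq_mul]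
  ring

theorem memLp_coord_momLaw_toLp {n : ℕ} (f : 𝓢(Conf n, ℂ)) (j : Fin n) :
    MemLp (fun p : Conf n => p j) 2 (momLaw (f.toLp 2 volume)) := by
  have h_fourier : Lp.fourierTransformₗᵢ (Conf n) ℂ (f.toLp 2 volume) = (𝓕 f).toLp 2 volume :=
    SchwartzMap.toLp_fourier_eq f
  rw [momLaw_eq_map, h_fourier, memLp_map_measure_iff (by fun_prop) (by fun_prop)]
  exact (memLp_coord_posLaw_toLp (𝓕 f) j).const_mul (2 * Real.pi)

/-! ### Mixtures of two opposite displacements -/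

section SymmMix

variable {E : Type*} [NormedAddCommGroup E] [MeasurableSpace E] {P : Measure E}

/-- The equal mixture of the translates of `P` by `v` and `-v`. -/
def symmMix (P : Measure E) (v : E) : Measure E :=
  (2⁻¹ : ℝ≥0∞) • (P.map (· + v) + P.map (· + -v))

theorem memLp_comp_add_const [NormedSpace ℝ E] [IsFiniteMeasure P] {f : StrongDual ℝ E}
    (hf : MemLp f 2 P) (u : E) : MemLp (fun y => f (y + u)) 2 P := by
  simp only [map_add]
  exact hf.add (memLp_const (f u))

variable [BorelSpace E]

instance isProbabilityMeasure_symmMix [IsProbabilityMeasure P] (v : E) :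
    IsProbabilityMeasure (symmMix P v) where
  measure_univ := by
    have (u : E) : IsProbabilityMeasure (P.map (· + u)) :=
      Measure.isProbabilityMeasure_map (by fun_prop)
    simp [symmMix, ENNReal.inv_two_add_inv_two]

theorem integrable_map_add_of_measurable {g : E → ℝ} (hg : Measurable g) {u : E}
    (h : Integrable (fun y => g (y + u)) P) : Integrable g (P.map (· + u)) :=
  (integrable_map_measure (by fun_prop) (by fun_prop)).2 h

theorem integrable_symmMix {g : E → ℝ} (hg : Measurable g) {v : E}
    (h : Integrable (fun y => g (y + v)) P) (h' : Integrable (fun y => g (y + -v)) P) :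
    Integrable g (symmMix P v) :=
  ((integrable_map_add_of_measurable hg h).add_measure
    (integrable_map_add_of_measurable hg h')).smul_measure (by simp)

theorem integral_symmMix {g : E → ℝ} (hg : Measurable g) {v : E}
    (h : Integrable (fun y => g (y + v)) P) (h' : Integrable (fun y => g (y + -v)) P) :
    ∫ y, g y ∂symmMix P v = ∫ y, (g (y + v) + g (y + -v)) / 2 ∂P := by
  rw [symmMix, integral_smul_measure, integral_add_measure (integrable_map_add_of_measurable hg h)
      (integrable_map_add_of_measurable hg h'), integral_map (by fun_prop) (by fun_prop),
    integral_map (by fun_prop) (by fun_prop), integral_div, integral_add h h',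
    ENNReal.toReal_inv, ENNReal.toReal_ofNat, smul_eq_mul, div_eq_inv_mul]

section Dual

variable [NormedSpace ℝ E] [IsProbabilityMeasure P] {f g : StrongDual ℝ E}

theorem memLp_symmMix (hf : MemLp f 2 P) (v : E) : MemLp f 2 (symmMix P v) :=
  (memLp_two_iff_integrable_sq (by fun_prop)).2
    (integrable_symmMix (by fun_prop) (memLp_comp_add_const hf v).integrable_sq
      (memLp_comp_add_const hf (-v)).integrable_sq)

theorem integral_dual_symmMix (hf : MemLp f 2 P) (v : E) :
    ∫ y, f y ∂symmMix P v = ∫ y, f y ∂P := by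
  rw [integral_symmMix (by fun_prop) ((memLp_comp_add_const hf v).integrable one_le_two)
    ((memLp_comp_add_const hf (-v)).integrable one_le_two)]
  congr 1 with y
  simp only [map_add, map_neg]
  ring

theorem integral_mul_symmMix (hf : MemLp f 2 P) (hg : MemLp g 2 P) (v : E) :
    ∫ y, f y * g y ∂symmMix P v = ∫ y, f y * g y ∂P + f v * g v := by
  have h_average (y : E) : (f (y + v) * g (y + v) + f (y + -v) * g (y + -v)) / 2 =
      f y * g y + f v * g v := by
    simp only [map_add, map_neg]
    ring
  rw [integral_symmMix (by fun_prop)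
      ((memLp_comp_add_const hf v).integrable_mul (memLp_comp_add_const hg v))
      ((memLp_comp_add_const hf (-v)).integrable_mul (memLp_comp_add_const hg (-v)))]
  simp only [h_average]
  exact (integral_add (hf.integrable_mul hg) (integrable_const _)).trans (by simp)

theorem covariance_symmMix (hf : MemLp f 2 P) (hg : MemLp g 2 P) (v : E) :
    cov[f, g; symmMix P v] = cov[f, g; P] + f v * g v := by
  rw [covariance_eq_sub (memLp_symmMix hf v) (memLp_symmMix hg v), covariance_eq_sub hf hg]
  simp only [Pi.mul_apply]
  rw [integral_mul_symmMix hf hg, integral_dual_symmMix hf, integral_dual_symmMix hg]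
  ring

end Dual

end SymmMix

theorem exists_negative_combination (d a V : ℝ) {b : ℝ} (hb : 0 < b) :
    ∃ L : ℝ, L ≠ 0 ∧ (d ≠ 0 → d ^ 2 * a * V - d * b * L < 0) := by
  obtain rfl | hd := eq_or_ne d 0
  · exact ⟨1, one_ne_zero, absurd rfl⟩
  refine ⟨d * ((|a * V| + 1) / b), by positivity, fun _ => ?_⟩
  calc d ^ 2 * a * V - d * b * (d * ((|a * V| + 1) / b))
    _ = d ^ 2 * (a * V - |a * V| - 1) := by field_simp; ring
    _ < 0 := mul_neg_of_pos_of_neg (by positivity) (by linarith [le_abs_self (a * V)])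

theorem exists_symmMix_covariance_ne_zero {n : ℕ} {P : Measure (Conf n)} [IsProbabilityMeasure P]
    (hP : ∀ k, MemLp (fun y : Conf n => y k) 2 P) {i j : Fin n} (hij : i ≠ j) (d a : ℝ) {b : ℝ}
    (hb : 0 < b) :
    ∃ v, cov[fun y => y i, fun y => y j; symmMix P v] ≠ 0 ∧
      (d ≠ 0 → d ^ 2 * a * Var[fun y => y i; symmMix P v]
        - d * b * cov[fun y => y i, fun y => y j; symmMix P v] < 0) := by
  have h_cov (k l : Fin n) (v : Conf n) : cov[fun y => y k, fun y => y l; symmMix P v] =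
      cov[fun y => y k, fun y => y l; P] + v k * v l :=
    covariance_symmMix (f := EuclideanSpace.proj k) (g := EuclideanSpace.proj l) (hP k) (hP l) v
  obtain ⟨L, hL₀, hL⟩ := exists_negative_combination d a (Var[fun y => y i; P] + 1) hb
  let v : Conf n := EuclideanSpace.single i 1 +
    EuclideanSpace.single j (L - cov[fun y => y i, fun y => y j; P])
  have hv_i : v i = 1 := by simp [v, hij]
  have hv_j : v j = L - cov[fun y => y i, fun y => y j; P] := by simp [v, hij.symm]
  have h_cov_v : cov[fun y => y i, fun y => y j; symmMix P v] = L := by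
    rw [h_cov, hv_i, hv_j]
    ring
  have h_var_v : Var[fun y => y i; symmMix P v] = Var[fun y => y i; P] + 1 := by
    rw [← covariance_self (by fun_prop), ← covariance_self (by fun_prop), h_cov, hv_i, mul_one]
  refine ⟨v, ?_⟩
  rw [h_cov_v, h_var_v]
  exact ⟨hL₀, hL⟩

/-- The probe state which is the equal mixture of the displacements of the wave function `f` by
`(v, 2πη)` and by `(-v, -2πη)` in phase space. -/
def displacedPair {f : Conf 2 → ℂ} (hf : MemLp f 2 volume) (hf_norm : ‖hf.toLp‖ = 1)
    (v η : Conf 2) : ProbeState (Fin 2) where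
  weight _ := 2⁻¹
  vec := ![(memLp_displace v η hf).toLp, (memLp_displace (-v) (-η) hf).toLp]
  weight_nonneg _ := by positivity
  weight_sum := by simpa using hasSum_fintype fun _ : Fin 2 => (2⁻¹ : ℝ)
  norm_vec := Fin.forall_fin_two.2 ⟨(norm_toLp_displace v η hf).trans hf_norm,
    (norm_toLp_displace (-v) (-η) hf).trans hf_norm⟩

section DisplacedPair

variable {f : Conf 2 → ℂ} (hf : MemLp f 2 volume) (hf_norm : ‖hf.toLp‖ = 1) (v η : Conf 2)

theorem mix_displacedPair (law : L2 (Conf 2) → Measure (Conf 2)) :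
    (displacedPair hf hf_norm v η).mix
        (fun i => law ((displacedPair hf hf_norm v η).vec i)) =
      (2⁻¹ : ℝ≥0∞) • (law (memLp_displace v η hf).toLp +
        law (memLp_displace (-v) (-η) hf).toLp) := by
  rw [ProbeState.mix, Measure.sum_fintype, Fin.sum_univ_two, smul_add]
  simp [displacedPair, ENNReal.ofReal_inv_of_pos]

theorem posLaw_displacedPair :
    (displacedPair hf hf_norm v η).posLaw = symmMix (posLaw hf.toLp) v := by
  rw [symmMix, ← posLaw_displace v η, ← posLaw_displace (-v) (-η)]
  exact mix_displacedPair hf hf_norm v η posLaw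

theorem momLaw_displacedPair (hf₁ : Integrable f) :
    (displacedPair hf hf_norm v η).momLaw = symmMix (momLaw hf.toLp) ((2 * Real.pi) • η) := by
  rw [symmMix, ← smul_neg, ← momLaw_displace v η hf₁, ← momLaw_displace (-v) (-η) hf₁]
  exact mix_displacedPair hf hf_norm v η momLaw

end DisplacedPair

theorem ProbeState.secondMomentsQ_of_symmMix {ι : Type*} {σ : ProbeState ι} {P : Measure (Conf 2)}
    [IsProbabilityMeasure P] {v : Conf 2} (hσ : σ.posLaw = symmMix P v)
    (hP : ∀ k, MemLp (fun y : Conf 2 => y k) 2 P) : σ.SecondMomentsQ := fun k => by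
  rw [hσ]
  exact (memLp_symmMix (f := EuclideanSpace.proj k) (hP k) v).integrable_sq

theorem ProbeState.secondMomentsP_of_symmMix {ι : Type*} {σ : ProbeState ι} {P : Measure (Conf 2)}
    [IsProbabilityMeasure P] {v : Conf 2} (hσ : σ.momLaw = symmMix P v)
    (hP : ∀ k, MemLp (fun y : Conf 2 => y k) 2 P) : σ.SecondMomentsP := fun k => by
  rw [hσ]
  exact (memLp_symmMix (f := EuclideanSpace.proj k) (hP k) v).integrable_sq

theorem exists_correlated_probe_disturbance_neg {lam mu : ℝ} (kap : ℝ) (hlam : 0 < lam)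
    (hmu : 0 < mu) :
    ∃ σ : ProbeState (Fin 2), σ.SecondMomentsQ ∧ σ.SecondMomentsP ∧ σ.covQ ≠ 0 ∧ σ.covP ≠ 0 ∧
      ∀ ψ : L2 ℝ, ‖ψ‖ = 1 →
        (kap ≠ 1 → Integrable (fun x => x ^ 2) (posLaw ψ) → deltaQ lam mu kap σ ψ < 0) ∧
        (kap ≠ -1 → Integrable (fun p => p ^ 2) (momLaw ψ) → deltaP lam mu kap σ ψ < 0) := by
  obtain ⟨f, hf⟩ := exists_schwartz_norm_toLp_eq_one (Conf 2)
  have := isProbabilityMeasure_posLaw hf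
  have := isProbabilityMeasure_momLaw hf
  obtain ⟨v, hv₀, hv⟩ := exists_symmMix_covariance_ne_zero (memLp_coord_posLaw_toLp f)
    one_ne_zero (1 - kap) (mu ^ 2 / 4) (div_pos hmu hlam)
  obtain ⟨w, hw₀, hw⟩ := exists_symmMix_covariance_ne_zero (memLp_coord_momLaw_toLp f)
    zero_ne_one (1 + kap) (lam ^ 2 / 4) (div_pos hlam hmu)
  let σ := displacedPair (f.memLp 2 volume) hf v ((2 * Real.pi)⁻¹ • w)
  have h_pos : σ.posLaw = symmMix (posLaw (f.toLp 2 volume)) v := posLaw_displacedPair ..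
  have h_mom : σ.momLaw = symmMix (momLaw (f.toLp 2 volume)) w := by
    refine (momLaw_displacedPair _ hf _ _ f.integrable).trans ?_
    rw [smul_inv_smul₀ (by positivity)]
    rfl
  have hQ := ProbeState.secondMomentsQ_of_symmMix h_pos (memLp_coord_posLaw_toLp f)
  have hP := ProbeState.secondMomentsP_of_symmMix h_mom (memLp_coord_momLaw_toLp f)
  rw [← h_pos, covariance_comm, ← hQ.covQ_eq, ← hQ.varQ_eq] at hv
  rw [← h_pos, covariance_comm, ← hQ.covQ_eq] at hv₀
  rw [← h_mom, ← hP.covP_eq, ← hP.varP_eq] at hw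
  rw [← h_mom, ← hP.covP_eq] at hw₀
  refine ⟨σ, hQ, hP, hv₀, hw₀, fun ψ hψ => ⟨fun hkap hψ₂ => ?_, fun hkap hψ₂ => ?_⟩⟩
  · calc deltaQ lam mu kap σ ψ
      _ = _ := deltaQ_eq kap hlam hmu hQ hψ hψ₂
      _ = (1 - kap) ^ 2 * (mu ^ 2 / 4) * σ.varQ 1 - (1 - kap) * (mu / lam) * σ.covQ := by ring
      _ < 0 := hv (sub_ne_zero.2 hkap.symm)
  · calc deltaP lam mu kap σ ψ
      _ = _ := deltaP_eq kap hlam hmu hP hψ hψ₂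
      _ = (1 + kap) ^ 2 * (lam ^ 2 / 4) * σ.varP 0 - (1 + kap) * (lam / mu) * σ.covP := by ring
      _ < 0 := hw fun h => hkap (by linarith)

end

end ArthursKelly

theorem mainTheorem2 (lam mu kap : ℝ) (hlam : 0 < lam) (hmu : 0 < mu) :
    -- the coupling unitaries `exp(-iH)` of the joint and of the two single-probe schemes exist
    -- and are determined by the Hamiltonian
    ((∃! U, IsExpNegI (hamiltonian lam mu kap) U) ∧
      (∃! U, IsExpNegI (hamiltonian lam 0 kap) U) ∧
      (∃! U, IsExpNegI (hamiltonian 0 mu kap) U)) ∧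
    (∀ (ι : Type*) [Countable ι] (σ : ProbeState ι),
      -- the marginals are smeared position and momentum observables
      (IsProbDensity (noiseE lam mu kap σ) ∧ IsProbDensity (noiseF lam mu kap σ) ∧
        (∀ X, MeasurableSet X →
          IsFunOfPos (obsE lam mu kap σ X) (smear X (noiseE lam mu kap σ))) ∧
        (∀ Y, MeasurableSet Y →
          IsFunOfMom (obsF lam mu kap σ Y) (smear Y (noiseF lam mu kap σ)))) ∧
      -- so are the observables measured by a single probe
      (IsProbDensity (noiseE0 lam σ) ∧ IsProbDensity (noiseF0 mu σ) ∧
        (∀ X, MeasurableSet X → IsFunOfPos (obsE0 lam kap σ X) (smear X (noiseE0 lam σ))) ∧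
        (∀ Y, MeasurableSet Y → IsFunOfMom (obsF0 mu kap σ Y) (smear Y (noiseF0 mu σ)))) ∧
      -- first moments
      (σ.FirstMomentsQ →
        Integrable (fun q => q * noiseE lam mu kap σ q) ∧
        moment1 (noiseE lam mu kap σ) =
          mu / 2 * (1 - kap) * σ.avgQ (fun x => x 1) - 1 / lam * σ.avgQ (fun x => x 0)) ∧
      (σ.FirstMomentsP →
        Integrable (fun p => p * noiseF lam mu kap σ p) ∧
        moment1 (noiseF lam mu kap σ) =
          lam / 2 * (1 + kap) * σ.avgP (fun p => p 0) - 1 / mu * σ.avgP (fun p => p 1)) ∧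
      -- second moments, variances, and the disturbance of position
      (σ.SecondMomentsQ →
        Integrable (fun q => q ^ 2 * noiseE lam mu kap σ q) ∧
        moment2 (noiseE lam mu kap σ) =
          mu ^ 2 / 4 * (1 - kap) ^ 2 * σ.avgQ (fun x => x 1 ^ 2)
            + 1 / lam ^ 2 * σ.avgQ (fun x => x 0 ^ 2)
            - mu / lam * (1 - kap) * σ.avgQ (fun x => x 0 * x 1) ∧
        densityVar (noiseE lam mu kap σ) =
          1 / lam ^ 2 * σ.varQ 0 + mu ^ 2 / 4 * (1 - kap) ^ 2 * σ.varQ 1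
            - mu / lam * (1 - kap) * σ.covQ ∧
        Integrable (fun q => q ^ 2 * noiseE0 lam σ q) ∧
        densityVar (noiseE0 lam σ) = 1 / lam ^ 2 * σ.varQ 0 ∧
        ∀ ψ : L2 ℝ, ‖ψ‖ = 1 → Integrable (fun x => x ^ 2) (posLaw ψ) →
          HasFiniteVar (obsE lam mu kap σ) ψ ∧ HasFiniteVar (obsE0 lam kap σ) ψ ∧
          deltaQ lam mu kap σ ψ =
            densityVar (noiseE lam mu kap σ) - densityVar (noiseE0 lam σ) ∧
          deltaQ lam mu kap σ ψ =
            (1 - kap) ^ 2 / 4 * mu ^ 2 * σ.varQ 1 - (1 - kap) / lam * mu * σ.covQ) ∧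
      -- second moments, variances, and the disturbance of momentum
      (σ.SecondMomentsP →
        Integrable (fun p => p ^ 2 * noiseF lam mu kap σ p) ∧
        moment2 (noiseF lam mu kap σ) =
          lam ^ 2 / 4 * (1 + kap) ^ 2 * σ.avgP (fun p => p 0 ^ 2)
            + 1 / mu ^ 2 * σ.avgP (fun p => p 1 ^ 2)
            - lam / mu * (1 + kap) * σ.avgP (fun p => p 0 * p 1) ∧
        densityVar (noiseF lam mu kap σ) =
          lam ^ 2 / 4 * (1 + kap) ^ 2 * σ.varP 0 + 1 / mu ^ 2 * σ.varP 1
            - lam / mu * (1 + kap) * σ.covP ∧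
        Integrable (fun p => p ^ 2 * noiseF0 mu σ p) ∧
        densityVar (noiseF0 mu σ) = 1 / mu ^ 2 * σ.varP 1 ∧
        ∀ ψ : L2 ℝ, ‖ψ‖ = 1 → Integrable (fun p => p ^ 2) (momLaw ψ) →
          HasFiniteVar (obsF lam mu kap σ) ψ ∧ HasFiniteVar (obsF0 mu kap σ) ψ ∧
          deltaP lam mu kap σ ψ =
            densityVar (noiseF lam mu kap σ) - densityVar (noiseF0 mu σ) ∧
          deltaP lam mu kap σ ψ =
            (1 + kap) ^ 2 / 4 * lam ^ 2 * σ.varP 0 - (1 + kap) / mu * lam * σ.covP)) ∧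
    -- the disturbances are negative for suitable correlated probes
    (∃ σ : ProbeState (Fin 2), σ.SecondMomentsQ ∧ σ.SecondMomentsP ∧
      σ.covQ ≠ 0 ∧ σ.covP ≠ 0 ∧
      ∀ ψ : L2 ℝ, ‖ψ‖ = 1 →
        (kap ≠ 1 → Integrable (fun x => x ^ 2) (posLaw ψ) → deltaQ lam mu kap σ ψ < 0) ∧
        (kap ≠ -1 → Integrable (fun p => p ^ 2) (momLaw ψ) → deltaP lam mu kap σ ψ < 0)) := by
  refine ⟨⟨existsUnique_isExpNegI_hamiltonian lam mu kap,
      existsUnique_isExpNegI_hamiltonian lam 0 kap, existsUnique_isExpNegI_hamiltonian 0 mu kap⟩,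
    fun ι _ σ => ?_, exists_correlated_probe_disturbance_neg kap hlam hmu⟩
  have hE := isDensityOf_noiseE hlam hmu kap σ
  have hF := isDensityOf_noiseF hlam hmu kap σ
  have hE0 := isDensityOf_noiseE0 hlam kap σ
  have hF0 := isDensityOf_noiseF0 hmu kap σ
  refine ⟨⟨hE.isProbDensity, hF.isProbDensity,
      fun X => (hasNoiseLaw_obsE σ kap hlam.ne' hmu.ne').isFunOfPos hE,
      fun Y => (hasNoiseLaw_obsF σ kap hlam.ne' hmu.ne').isFunOfMom hF⟩,
    ⟨hE0.isProbDensity, hF0.isProbDensity,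
      fun X => (hasNoiseLaw_obsE0 σ kap hlam.ne').isFunOfPos hE0,
      fun Y => (hasNoiseLaw_obsF0 σ kap hmu.ne').isFunOfMom hF0⟩,
    fun hQ => ⟨integrable_mul_noiseE kap hlam hmu hQ, moment1_noiseE kap hlam hmu hQ⟩,
    fun hP => ⟨integrable_mul_noiseF kap hlam hmu hP, moment1_noiseF kap hlam hmu hP⟩,
    fun hQ => ⟨integrable_sq_mul_noiseE kap hlam hmu hQ, moment2_noiseE kap hlam hmu hQ,
      densityVar_noiseE kap hlam hmu hQ, integrable_sq_mul_noiseE0 hlam hQ,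
      densityVar_noiseE0 hlam hQ, fun ψ hψ hψ₂ =>
        ⟨hasFiniteVar_obsE kap hlam.ne' hmu.ne' hQ hψ hψ₂,
          hasFiniteVar_obsE0 kap hlam.ne' hQ hψ hψ₂,
          deltaQ_eq_densityVar_sub kap hlam hmu hQ hψ hψ₂, deltaQ_eq kap hlam hmu hQ hψ hψ₂⟩⟩,
    fun hP => ⟨integrable_sq_mul_noiseF kap hlam hmu hP, moment2_noiseF kap hlam hmu hP,
      densityVar_noiseF kap hlam hmu hP, integrable_sq_mul_noiseF0 hmu hP,
      densityVar_noiseF0 hmu hP, fun ψ hψ hψ₂ =>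
        ⟨hasFiniteVar_obsF kap hlam.ne' hmu.ne' hP hψ hψ₂,
          hasFiniteVar_obsF0 kap hmu.ne' hP hψ hψ₂,
          deltaP_eq_densityVar_sub kap hlam hmu hP hψ hψ₂, deltaP_eq kap hlam hmu hP hψ hψ₂⟩⟩⟩
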